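/- Let $d \ge 1$, $\nu = (\nu_1,\dots,\nu_d) \in \mathbb N^d$ and $1 \le r < \infty$. Let $\mathcal S_d$ (resp. $\mathcal S_d^{+,*}$) be the set of real symmetric (resp. symmetric positive definite) $d\times d$ matrices. Let $\mathcal G$ be the set of functions $\mathbb R^d \to \mathbb C$ of the form $$x \mapsto a\, e^{-\frac12 (x-q)\cdot Q(x-q)}\, e^{i p\cdot (x-q)},\qquad a \in \mathbb C,\ p,q\in\mathbb R^d,\ Q = A+iB,\ A\in\mathcal S_d^{+,*},\ B\in\mathcal S_d,$$ let $\mathbb C^\nu[x_1,\dots,x_d]$ be the space of complex polynomials of degree at most $\nu_j$ in $x_j$ for each $j$, and let $\mathcal G_\nu = \{P g : P\in \mathbb C^\nu[x_1,\dots,x_d],\ g\in\mathcal G\}$. Functions in $L^1_{loc}$ and $L^r$ are identified when they agree almost everywhere. For $k\in\mathbb N$ let $P_k\in\mathbb C^\nu[x_1,\dots,x_d]$, $p_k,q_k\in\mathbb R^d$, $A_k\in\mathcal S_d^{+,*}$, $B_k\in\mathcal S_d$, $Q_k=A_k+iB_k$, and $$g_k(x) = P_k(x)\, e^{-\frac12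 (x-q_k)\cdot Q_k(x-q_k)}\, e^{i p_k\cdot (x-q_k)} .$$ Assume that $\sup_k \|g_k\|_{L^r} < \infty$ and that $g_k \to g$ in the sense of distributions for some $g\in L^1_{loc}(\mathbb R^d)$. Then one of the following holds: (i) $g = 0$; (ii) $g\in\mathcal G_\nu\setminus\{0\}$, and there are $P\in\mathbb C^\nu[x_1,\dots,x_d]$, $p,q\in\mathbb R^d$ and $Q=A+iB$ with $A\in\mathcal S_d^{+,*}$, $B\in\mathcal S_d$ such that $g(x) = P(x)\, e^{-\frac12 (x-q)\cdot Q(x-q)}\, e^{i p\cdot (x-q)}$ and, as $k\to\infty$, $P_k\to P$ (coefficient by coefficient), $p_k\to p$, $q_k\to q$, $Q_k\to Q$, and $\|g_k-g\|_{L^s}\to 0$ for every $1\le s\le\infty$. Consequently, $\mathcal G_\nu$ is a closed subset of $L^r(\mathbb R^d)$ for the weak topology. -/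

import Mathlib

open MeasureTheory Filter Topology
open scoped ENNReal ContDiff

namespace GaussianWavePacket

/-- The point `x ∈ ℝ^d`, regarded as a vector of `ℂ^d`. -/
def cvec {d : ℕ} (x : EuclideanSpace ℝ (Fin d)) : Fin d → ℂ := fun j => (x j : ℂ)

/-- The complex matrix `A + iB` built from two real matrices. -/
def cmat {d : ℕ} (A B : Matrix (Fin d) (Fin d) ℝ) : Matrix (Fin d) (Fin d) ℂ :=
  Matrix.of fun i j => (A i j : ℂ) + Complex.I * (B i j : ℂ)

/-- The function `x ↦ exp (-½ (x - q) · Q (x - q)) * exp (i p · (x - q))` with `Q` a complex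
matrix; the dot is the bilinear one (no conjugation). -/
noncomputable def gaussianPhase {d : ℕ} (p q : EuclideanSpace ℝ (Fin d))
    (Q : Matrix (Fin d) (Fin d) ℂ) (x : EuclideanSpace ℝ (Fin d)) : ℂ :=
  Complex.exp (-(1 / 2 : ℂ) * dotProduct (cvec (x - q)) (Q.mulVec (cvec (x - q)))) *
    Complex.exp (Complex.I * dotProduct (cvec p) (cvec (x - q)))

/-- The function `x ↦ P(x) exp (-½ (x - q) · Q (x - q)) exp (i p · (x - q))`. -/
noncomputable def wavePacket {d : ℕ} (P : MvPolynomial (Fin d) ℂ)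
    (p q : EuclideanSpace ℝ (Fin d)) (Q : Matrix (Fin d) (Fin d) ℂ)
    (x : EuclideanSpace ℝ (Fin d)) : ℂ :=
  MvPolynomial.eval (cvec x) P * gaussianPhase p q Q x

/-- The set `𝒢` of Gaussian wave packets `x ↦ a exp (-½ (x - q) · Q (x - q)) exp (i p · (x - q))`
with `a ∈ ℂ`, `p, q ∈ ℝ^d` and `Q = A + iB`, `A` symmetric positive definite, `B` symmetric. -/
def gaussians (d : ℕ) : Set (EuclideanSpace ℝ (Fin d) → ℂ) :=
  {g | ∃ (a : ℂ) (p q : EuclideanSpace ℝ (Fin d)) (A B : Matrix (Fin d) (Fin d) ℝ),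
    A.PosDef ∧ B.IsSymm ∧ g = fun x => a * gaussianPhase p q (cmat A B) x}

/-- The space `ℂ^ν[x_1, …, x_d]` of complex polynomials of degree at most `ν_j` in `x_j`. -/
def boxPolynomials {d : ℕ} (ν : Fin d → ℕ) : Set (MvPolynomial (Fin d) ℂ) :=
  {P | ∀ j, P.degreeOf j ≤ ν j}

/-- The set `𝒢_ν = {P g : P ∈ ℂ^ν[x_1, …, x_d], g ∈ 𝒢}`, as a set of functions. -/
def polyGaussians {d : ℕ} (ν : Fin d → ℕ) : Set (EuclideanSpace ℝ (Fin d) → ℂ) :=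
  {f | ∃ P ∈ boxPolynomials ν, ∃ g ∈ gaussians d,
    f = fun x => MvPolynomial.eval (cvec x) P * g x}

/-- The set `𝒢_ν` as a subset of `L^r(ℝ^d)`: the classes that have a representative in `𝒢_ν`. -/
def polyGaussiansLp {d : ℕ} (ν : Fin d → ℕ) (r : ℝ≥0∞) :
    Set (Lp ℂ r (volume : Measure (EuclideanSpace ℝ (Fin d)))) :=
  {f | ∃ h ∈ polyGaussians ν, ⇑f =ᵐ[volume] h}

/-- Convergence `g_k ⇀ g` in the sense of distributions on `ℝ^d`. -/
def TendstoDistribution {d : ℕ} (g : ℕ → EuclideanSpace ℝ (Fin d) → ℂ)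
    (l : EuclideanSpace ℝ (Fin d) → ℂ) : Prop :=
  ∀ φ : EuclideanSpace ℝ (Fin d) → ℂ, ContDiff ℝ ∞ φ → HasCompactSupport φ →
    Tendsto (fun k => ∫ x, g k x * φ x) atTop (𝓝 (∫ x, l x * φ x))

end GaussianWavePacket

namespace GaussianWavePacket

/-! Expanding the square turns a wave packet into `P exp (-½ x · Q x + b · x)` with `b = Q q + i p`,
a constant being absorbed into `P`. Such a function is annihilated, in the sense of distributions,
by the power `ν_j + 1` of a first order operator with affine coefficients: each integration by parts
against `∂_j + (b_j - (Q x)_j)` replaces `P` by `-∂_j P` (`pairing_firstOrderOp_pow_eq_zero`).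

The coefficient vector `(1, -Q_j, b_j)` may be unbounded, but after normalisation it has a nonzero
limit along any ultrafilter, and the limit operator, raised to the same power, annihilates the limit
function. If the coefficient of `∂_j` vanishes in the limit, the operator is multiplication by a
nonzero affine function, which forces the limit function to be zero. Otherwise the norms of the
vectors converge, hence so do `Q` and `b` (`exists_tendsto_phase`). The same normalisation applied
to `(1, coefficients of P)` gives convergence of `P` (`exists_tendsto_coeff`). Since the function
determines its parameters (`polyExp_injective`), all ultrafilters give the same limits, and the
convergence holds along the original filter.

The limit matrix has only `Re Q ≥ 0`. Fatou's lemma bounds the `L^r` norm of the limit, and a kernel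
direction of `Re Q` would be a direction in which the function cannot decay, so `Re Q > 0`
(`posDef_of_eLpNorm_lt_top`). Then `q = (Re Q)⁻¹ Re b` and `p = Im b - (Im Q) q` depend continuously
on `(Q, b)`, and a uniform Gaussian bound gives convergence in every `L^s`
(`tendsto_eLpNorm_polyExp`).

Weak closedness follows from the same argument along ultrafilters, because pairing with a test
function is weakly continuous on `L^r`. -/

/-- The Euclidean space `ℝ^d`. -/
abbrev Space (d : ℕ) := EuclideanSpace ℝ (Fin d)

/-! ### Expanded form, test functions and first order operators -/

/-- The phase `x ↦ -½ x · Q x + b · x`. -/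
noncomputable def quadPhase {d : ℕ} (Q : Matrix (Fin d) (Fin d) ℂ) (b : Fin d → ℂ)
    (x : Space d) : ℂ :=
  -(1 / 2 : ℂ) * dotProduct (cvec x) (Q.mulVec (cvec x)) + dotProduct b (cvec x)

/-- The function `x ↦ P(x) exp (-½ x · Q x + b · x)`. -/
noncomputable def polyExp {d : ℕ} (P : MvPolynomial (Fin d) ℂ) (Q : Matrix (Fin d) (Fin d) ℂ)
    (b : Fin d → ℂ) (x : Space d) : ℂ :=
  MvPolynomial.eval (cvec x) P * Complex.exp (quadPhase Q b x)

/-- The smooth compactly supported functions on `ℝ^d`, as a complex vector space. -/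
def testFunctions (d : ℕ) : Submodule ℂ (Space d → ℂ) where
  carrier := {φ | ContDiff ℝ ∞ φ ∧ HasCompactSupport φ}
  zero_mem' := ⟨contDiff_const, HasCompactSupport.zero⟩
  add_mem' ha hb := ⟨ha.1.add hb.1, ha.2.add hb.2⟩
  smul_mem' _ _ h := ⟨contDiff_const.smul h.1, h.2.smul_left⟩

/-- The partial derivative in direction `j` as an operator on test functions. -/
noncomputable def testPartial {d : ℕ} (j : Fin d) : Module.End ℂ (testFunctions d) where
  toFun φ := ⟨fun x => fderiv ℝ φ.1 x (EuclideanSpace.single j 1),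
    (φ.2.1.fderiv_right (m := ∞) (by simp)).clm_apply contDiff_const,
    φ.2.2.fderiv_apply (𝕜 := ℝ) _⟩
  map_add' φ ψ := by
    ext x
    have h1 : DifferentiableAt ℝ φ.1 x := (φ.2.1.differentiable (by simp)).differentiableAt
    have h2 : DifferentiableAt ℝ ψ.1 x := (ψ.2.1.differentiable (by simp)).differentiableAt
    simp [fderiv_add h1 h2]
  map_smul' c φ := by
    ext x
    have h1 : DifferentiableAt ℝ φ.1 x := (φ.2.1.differentiable (by simp)).differentiableAt
    simp [fderiv_const_smul h1 c]

theorem contDiff_coord {d : ℕ} (j : Fin d) : ContDiff ℝ ∞ (fun x : Space d => (x j : ℂ)) :=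
  Complex.ofRealCLM.contDiff.comp (EuclideanSpace.proj (𝕜 := ℝ) j).contDiff

/-- Multiplication by the coordinate `x_j` as an operator on test functions. -/
noncomputable def testMul {d : ℕ} (j : Fin d) : Module.End ℂ (testFunctions d) where
  toFun φ := ⟨fun x => (x j : ℂ) * φ.1 x, (contDiff_coord j).mul φ.2.1, φ.2.2.mul_left⟩
  map_add' φ ψ := by ext x; simp [mul_add]
  map_smul' c φ := by ext x; simp [mul_left_comm]

theorem integrable_mul_test {d : ℕ} {f : Space d → ℂ} (hf : LocallyIntegrable f volume)
    (φ : testFunctions d) : Integrable (fun x => f x * φ.1 x) volume := by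
  simpa [smul_eq_mul, mul_comm] using
    hf.integrable_smul_left_of_hasCompactSupport φ.2.1.continuous φ.2.2

/-- The pairing of a locally integrable function with test functions. -/
noncomputable def pairing {d : ℕ} (f : Space d → ℂ) (hf : LocallyIntegrable f volume) :
    testFunctions d →ₗ[ℂ] ℂ where
  toFun φ := ∫ x, f x * φ.1 x
  map_add' φ ψ := by
    rw [← integral_add (integrable_mul_test hf φ) (integrable_mul_test hf ψ)]
    simp [mul_add]
  map_smul' c φ := by
    rw [RingHom.id_apply, smul_eq_mul, ← integral_const_mul]
    simp [mul_left_comm]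

/-- The operator `φ ↦ a ∂_j φ + (u · x + w) φ` on test functions, for `α = (a, u, w)`. -/
noncomputable def firstOrderOp {d : ℕ} (j : Fin d) (α : ℂ × (Fin d → ℂ) × ℂ) :
    Module.End ℂ (testFunctions d) :=
  α.1 • testPartial j + ∑ i, α.2.1 i • testMul i + α.2.2 • LinearMap.id

/-- Convergence is only known on each fixed test function, while the test function here moves with
the coefficients. Peeling off one factor at a time writes the moving one as a combination of fixed
test functions with convergent scalar coefficients. -/
theorem tendsto_firstOrderOp_pow {d : ℕ} {ι : Type*} {l : Filter ι} (j : Fin d)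
    {Λ : ι → testFunctions d →ₗ[ℂ] ℂ} {Λ' : testFunctions d →ₗ[ℂ] ℂ}
    (hΛ : ∀ φ, Tendsto (fun k => Λ k φ) l (𝓝 (Λ' φ)))
    {α : ι → ℂ × (Fin d → ℂ) × ℂ} {α' : ℂ × (Fin d → ℂ) × ℂ} (hα : Tendsto α l (𝓝 α')) (N : ℕ)
    (φ : testFunctions d) :
    Tendsto (fun k => Λ k ((firstOrderOp j (α k) ^ N) φ)) l
      (𝓝 (Λ' ((firstOrderOp j α' ^ N) φ))) := by
  induction N generalizing φ with
  | zero => simpa using hΛ φ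
  | succ N ih =>
    have h1 : Tendsto (fun k => (α k).1) l (𝓝 α'.1) := (continuous_fst.tendsto _).comp hα
    have h2 : ∀ i, Tendsto (fun k => (α k).2.1 i) l (𝓝 (α'.2.1 i)) := fun i =>
      (((continuous_apply i).comp (continuous_fst.comp continuous_snd)).tendsto α').comp hα
    have h3 : Tendsto (fun k => (α k).2.2) l (𝓝 α'.2.2) :=
      ((continuous_snd.comp continuous_snd).tendsto α').comp hα
    have key : ∀ (M : testFunctions d →ₗ[ℂ] ℂ) (β : ℂ × (Fin d → ℂ) × ℂ),
        M ((firstOrderOp j β ^ (N + 1)) φ) =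
          β.1 * M ((firstOrderOp j β ^ N) (testPartial j φ)) +
          ∑ i, β.2.1 i * M ((firstOrderOp j β ^ N) (testMul i φ)) +
          β.2.2 * M ((firstOrderOp j β ^ N) φ) := by
      intro M β
      rw [pow_succ, Module.End.mul_apply]
      conv_lhs => rw [show firstOrderOp j β φ = β.1 • testPartial j φ +
        ∑ i, β.2.1 i • testMul i φ + β.2.2 • φ by simp [firstOrderOp]]
      simp
    simp only [key]
    exact ((h1.mul (ih _)).add (tendsto_finsetSum _ fun i _ => (h2 i).mul (ih _))).add
      (h3.mul (ih _))

/-! ### Derivatives of polynomial times exponential, and integration by parts -/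

theorem continuous_cvec {d : ℕ} : Continuous (cvec (d := d)) := by
  unfold cvec; fun_prop

theorem cvec_add_smul {d : ℕ} (x v : Space d) (t : ℝ) :
    cvec (x + t • v) = cvec x + (t : ℂ) • cvec v := by
  ext i; simp [cvec]

theorem cvec_single {d : ℕ} (j : Fin d) :
    cvec (EuclideanSpace.single j (1 : ℝ)) = Pi.single j 1 := by
  ext i; by_cases h : i = j <;> simp [cvec, h]

theorem continuous_eval_cvec {d : ℕ} (P : MvPolynomial (Fin d) ℂ) :
    Continuous fun x : Space d => MvPolynomial.eval (cvec x) P :=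
  (MvPolynomial.continuous_eval P).comp continuous_cvec

theorem continuous_quadPhase {d : ℕ} (Q : Matrix (Fin d) (Fin d) ℂ) (b : Fin d → ℂ) :
    Continuous (quadPhase Q b) := by
  have := continuous_cvec (d := d)
  unfold quadPhase
  fun_prop

theorem continuous_polyExp {d : ℕ} (P : MvPolynomial (Fin d) ℂ) (Q : Matrix (Fin d) (Fin d) ℂ)
    (b : Fin d → ℂ) : Continuous (polyExp P Q b) :=
  (continuous_eval_cvec P).mul (continuous_quadPhase Q b).cexp

theorem quadPhase_add_smul {d : ℕ} {Q : Matrix (Fin d) (Fin d) ℂ} (hQ : Q.IsSymm)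
    (b : Fin d → ℂ) (x v : Space d) (t : ℝ) :
    quadPhase Q b (x + t • v) = quadPhase Q b x +
      t * (dotProduct b (cvec v) - dotProduct (cvec v) (Q.mulVec (cvec x))) -
      (1 / 2 : ℂ) * t ^ 2 * dotProduct (cvec v) (Q.mulVec (cvec v)) := by
  have h : dotProduct (cvec x) (Q.mulVec (cvec v)) = dotProduct (cvec v) (Q.mulVec (cvec x)) := by
    rw [Matrix.dotProduct_mulVec, ← Matrix.mulVec_transpose, hQ.eq, dotProduct_comm]
  simp only [quadPhase, cvec_add_smul, Matrix.mulVec_add, Matrix.mulVec_smul, dotProduct_add,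
    add_dotProduct, dotProduct_smul, smul_dotProduct, smul_eq_mul, h]
  ring

theorem hasLineDerivAt_quadPhase {d : ℕ} {Q : Matrix (Fin d) (Fin d) ℂ} (hQ : Q.IsSymm)
    (b : Fin d → ℂ) (x v : Space d) :
    HasLineDerivAt ℝ (quadPhase Q b)
      (dotProduct b (cvec v) - dotProduct (cvec v) (Q.mulVec (cvec x))) x v := by
  unfold HasLineDerivAt
  simp only [quadPhase_add_smul hQ]
  have h1 : HasDerivAt (fun t : ℝ => (t : ℂ)) 1 0 := Complex.ofRealCLM.hasDerivAt
  have h2 := h1.pow 2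
  refine (((h1.mul_const _).const_add _).sub ((h2.const_mul (1 / 2 : ℂ)).mul_const _)).congr_deriv ?_
  simp

theorem hasLineDerivAt_eval {d : ℕ} (P : MvPolynomial (Fin d) ℂ) (x : Space d) (j : Fin d) :
    HasLineDerivAt ℝ (fun y => MvPolynomial.eval (cvec y) P)
      (MvPolynomial.eval (cvec x) (MvPolynomial.pderiv j P)) x (EuclideanSpace.single j 1) := by
  unfold HasLineDerivAt
  induction P using MvPolynomial.induction_on with
  | C a => simpa using hasDerivAt_const (0 : ℝ) a
  | add p q hp hq =>
    simp only [map_add]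
    exact hp.add hq
  | mul_X p i hp =>
    have h1 : HasDerivAt (fun t : ℝ => (t : ℂ)) 1 0 := Complex.ofRealCLM.hasDerivAt
    have h2 : HasDerivAt (fun t : ℝ => cvec (x + t • EuclideanSpace.single j (1 : ℝ)) i)
        ((Pi.single j 1 : Fin d → ℂ) i) 0 := by
      simp only [cvec_add_smul, cvec_single, Pi.add_apply, Pi.smul_apply, smul_eq_mul]
      simpa using (h1.mul_const ((Pi.single j 1 : Fin d → ℂ) i)).const_add (cvec x i)
    have h3 := hp.mul h2
    simp only [MvPolynomial.eval_mul, MvPolynomial.eval_X]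
    refine h3.congr_deriv ?_
    by_cases h : i = j
    · subst h
      simp
      ring
    · simp [MvPolynomial.pderiv_X_of_ne h, h, mul_comm]

theorem hasLineDerivAt_polyExp {d : ℕ} (P : MvPolynomial (Fin d) ℂ)
    {Q : Matrix (Fin d) (Fin d) ℂ} (hQ : Q.IsSymm) (b : Fin d → ℂ) (x : Space d) (j : Fin d) :
    HasLineDerivAt ℝ (polyExp P Q b)
      (polyExp (MvPolynomial.pderiv j P) Q b x + (b j - Q.mulVec (cvec x) j) * polyExp P Q b x)
      x (EuclideanSpace.single j 1) := by
  have h1 := hasLineDerivAt_eval P x j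
  have h2 := hasLineDerivAt_quadPhase hQ b x (EuclideanSpace.single j 1)
  unfold HasLineDerivAt at *
  refine (h1.mul h2.cexp).congr_deriv ?_
  simp only [cvec_single, dotProduct_single, single_dotProduct, zero_smul, add_zero, polyExp]
  ring

/-- The coefficients of the first order operator `∂_j + (b_j - (Q x)_j)`. -/
def phaseCoeff {d : ℕ} (j : Fin d) (Q : Matrix (Fin d) (Fin d) ℂ) (b : Fin d → ℂ) :
    ℂ × (Fin d → ℂ) × ℂ := (1, -Q j, b j)

theorem firstOrderOp_apply {d : ℕ} (j : Fin d) (α : ℂ × (Fin d → ℂ) × ℂ) (φ : testFunctions d)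
    (x : Space d) : (firstOrderOp j α φ).1 x =
      α.1 * fderiv ℝ φ.1 x (EuclideanSpace.single j 1) +
        (dotProduct α.2.1 (cvec x) + α.2.2) * φ.1 x := by
  simp [firstOrderOp, testPartial, testMul, dotProduct, cvec, Finset.sum_mul, Finset.sum_apply,
    add_mul, mul_assoc, add_assoc]

theorem firstOrderOp_smul {d : ℕ} (j : Fin d) (s : ℂ) (α : ℂ × (Fin d → ℂ) × ℂ) :
    firstOrderOp j (s • α) = s • firstOrderOp j α := by
  simp [firstOrderOp, smul_add, Finset.smul_sum, mul_smul]

/-- After integration by parts, the term coming from the derivative of the exponential cancels the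
multiplication term of the operator, and only the derivative of the polynomial survives. -/
theorem pairing_firstOrderOp {d : ℕ} (j : Fin d) (P : MvPolynomial (Fin d) ℂ)
    {Q : Matrix (Fin d) (Fin d) ℂ} (hQ : Q.IsSymm) (b : Fin d → ℂ) (φ : testFunctions d) :
    pairing (polyExp P Q b) (continuous_polyExp P Q b).locallyIntegrable
        (firstOrderOp j (phaseCoeff j Q b) φ) =
      -pairing (polyExp (MvPolynomial.pderiv j P) Q b)
        (continuous_polyExp _ Q b).locallyIntegrable φ := by
  have hc := continuous_polyExp P Q b
  have hc' := continuous_polyExp (MvPolynomial.pderiv j P) Q b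
  have hl : Continuous fun x : Space d => b j - Q.mulVec (cvec x) j := by
    have := continuous_cvec (d := d)
    fun_prop
  have i1 := integrable_mul_test hc'.locallyIntegrable φ
  have i2 : Integrable (fun x => ((b j - Q.mulVec (cvec x) j) * polyExp P Q b x) * φ.1 x) volume :=
    integrable_mul_test (hl.mul hc).locallyIntegrable φ
  have i3 : Integrable (fun x => polyExp P Q b x *
      fderiv ℝ φ.1 x (EuclideanSpace.single j 1)) volume :=
    integrable_mul_test hc.locallyIntegrable (testPartial j φ)
  have key := integral_bilinear_hasLineDerivAt_right_eq_neg_left_of_integrable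
    (μ := (volume : Measure (Space d))) (B := ContinuousLinearMap.mul ℝ ℂ)
    (f := polyExp P Q b) (g := φ.1)
    (f' := fun x => polyExp (MvPolynomial.pderiv j P) Q b x +
      (b j - Q.mulVec (cvec x) j) * polyExp P Q b x)
    (g' := fun x => fderiv ℝ φ.1 x (EuclideanSpace.single j 1)) (v := EuclideanSpace.single j 1)
    (by simpa only [ContinuousLinearMap.mul_apply', add_mul] using! i1.add i2) (by simpa using i3)
    (by simpa using integrable_mul_test hc.locallyIntegrable φ)
    (fun x _ => hasLineDerivAt_polyExp P hQ b x j)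
    (fun x _ => ((φ.2.1.differentiable (by simp)) x).hasFDerivAt.hasLineDerivAt _)
  simp only [ContinuousLinearMap.mul_apply'] at key
  have e1 : ∀ x, polyExp P Q b x * (firstOrderOp j (phaseCoeff j Q b) φ).1 x =
      polyExp P Q b x * fderiv ℝ φ.1 x (EuclideanSpace.single j 1) +
        ((b j - Q.mulVec (cvec x) j) * polyExp P Q b x) * φ.1 x := by
    intro x
    rw [firstOrderOp_apply]
    simp only [phaseCoeff, neg_dotProduct, Matrix.mulVec]
    ring
  simp only [pairing, LinearMap.coe_mk, AddHom.coe_mk]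
  simp_rw [e1]
  rw [integral_add i3 i2, key]
  simp_rw [add_mul]
  rw [integral_add i1 i2]
  ring

theorem pairing_firstOrderOp_pow {d : ℕ} (j : Fin d) (P : MvPolynomial (Fin d) ℂ)
    {Q : Matrix (Fin d) (Fin d) ℂ} (hQ : Q.IsSymm) (b : Fin d → ℂ) (φ : testFunctions d) (N : ℕ) :
    pairing (polyExp P Q b) (continuous_polyExp P Q b).locallyIntegrable
        ((firstOrderOp j (phaseCoeff j Q b) ^ N) φ) =
      (-1) ^ N * pairing (polyExp ((MvPolynomial.pderiv j)^[N] P) Q b)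
        (continuous_polyExp _ Q b).locallyIntegrable φ := by
  induction N generalizing P with
  | zero => simp
  | succ N ih =>
    rw [pow_succ', Module.End.mul_apply, pairing_firstOrderOp j P hQ, ih]
    simp only [Function.iterate_succ, Function.comp_apply]
    ring

theorem degreeOf_pderiv_le {d : ℕ} (j : Fin d) (P : MvPolynomial (Fin d) ℂ) :
    (MvPolynomial.pderiv j P).degreeOf j ≤ P.degreeOf j - 1 := by
  rw [MvPolynomial.degreeOf_le_iff]
  intro m hm
  rw [MvPolynomial.mem_support_iff, MvPolynomial.coeff_pderiv] at hm
  have h : m + Finsupp.single j 1 ∈ P.support := by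
    rw [MvPolynomial.mem_support_iff]
    intro h0
    simp [h0] at hm
  have := MvPolynomial.degreeOf_le_iff.mp (le_refl (P.degreeOf j)) _ h
  simp at this
  omega

theorem pderiv_iterate_eq_zero {d : ℕ} (j : Fin d) (N : ℕ) (P : MvPolynomial (Fin d) ℂ)
    (h : P.degreeOf j < N) : (MvPolynomial.pderiv j)^[N] P = 0 := by
  induction N generalizing P with
  | zero => omega
  | succ N ih =>
    rw [Function.iterate_succ_apply]
    rcases Nat.eq_zero_or_pos (P.degreeOf j) with h0 | h0
    · rw [MvPolynomial.pderiv_eq_zero_of_notMem_vars]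
      · exact iterate_map_zero _ N
      · rw [MvPolynomial.mem_vars_iff_mem_support]
        rintro ⟨m, hm, hj⟩
        exact Finsupp.mem_support_iff.mp hj
          (Nat.le_zero.mp (MvPolynomial.degreeOf_le_iff.mp h0.le m hm))
    · exact ih _ (lt_of_le_of_lt (degreeOf_pderiv_le j P) (by omega))

/-- Each application lowers the degree in `x_j`. The scalar `s` is there for the normalisation:
annihilation is insensitive to rescaling the operator. -/
theorem pairing_firstOrderOp_pow_eq_zero {d : ℕ} (j : Fin d) (P : MvPolynomial (Fin d) ℂ)
    {Q : Matrix (Fin d) (Fin d) ℂ} (hQ : Q.IsSymm) (b : Fin d → ℂ) (s : ℂ) (φ : testFunctions d)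
    {N : ℕ} (h : P.degreeOf j < N) :
    pairing (polyExp P Q b) (continuous_polyExp P Q b).locallyIntegrable
        ((firstOrderOp j (s • phaseCoeff j Q b) ^ N) φ) = 0 := by
  rw [firstOrderOp_smul, smul_pow, LinearMap.smul_apply, map_smul,
    pairing_firstOrderOp_pow j P hQ, pderiv_iterate_eq_zero j N P h]
  simp [pairing, polyExp]

/-! ### Compactness and convergence of the phase -/

/-- The normalised vectors lie on the unit sphere, which is compact in finite dimension and does not
contain zero. -/
theorem exists_tendsto_normalize {ι F : Type*} [NormedAddCommGroup F] [NormedSpace ℂ F]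
    [FiniteDimensional ℂ F] (U : Ultrafilter ι) (β : ι → F) (hβ : ∀ k, β k ≠ 0) :
    ∃ α : F, α ≠ 0 ∧ Tendsto (fun k => ((‖β k‖ : ℂ)⁻¹) • β k) U (𝓝 α) := by
  have : ProperSpace F := FiniteDimensional.proper ℂ F
  obtain ⟨α, hα, hlim⟩ := (isCompact_sphere (0 : F) 1).ultrafilter_le_nhds'
    (U.map fun k => ((‖β k‖ : ℂ)⁻¹) • β k) (by
      refine Filter.mem_map.2 (Filter.univ_mem' fun k => ?_)
      have := norm_ne_zero_iff.2 (hβ k)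
      simp [norm_smul, this])
  refine ⟨α, ?_, hlim⟩
  rintro rfl
  simp at hα

/-- When `u ≠ 0`, the zero set is empty or a translate of the kernel of a nonzero real-linear map, a
proper subspace and thus a null set. -/
theorem ae_affine_ne_zero {d : ℕ} (u : Fin d → ℂ) (w : ℂ) (h : ¬ (u = 0 ∧ w = 0)) :
    ∀ᵐ x : Space d, dotProduct u (cvec x) + w ≠ 0 := by
  by_cases hu : u = 0
  · refine Filter.Eventually.of_forall fun x => ?_
    simpa [hu] using fun hw => h ⟨hu, hw⟩
  obtain ⟨i, hi⟩ : ∃ i, u i ≠ 0 := by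
    by_contra! hc
    exact hu (funext hc)
  let L : Space d →ₗ[ℝ] ℂ := ∑ j, u j • (Complex.ofRealCLM.toLinearMap ∘ₗ
    (EuclideanSpace.proj (𝕜 := ℝ) j).toLinearMap)
  have hL : ∀ x, dotProduct u (cvec x) = L x := by
    intro x
    simp [L, dotProduct, cvec]
  by_cases hx : ∃ x0, L x0 + w = 0
  swap
  · push Not at hx
    exact Filter.Eventually.of_forall fun x => by rw [hL]; exact hx x
  obtain ⟨x0, hx0⟩ := hx
  have hker : LinearMap.ker L ≠ ⊤ := by
    intro ht
    have : L (EuclideanSpace.single i 1) = 0 := by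
      rw [LinearMap.ker_eq_top.1 ht]; rfl
    rw [← hL, cvec_single] at this
    simp at this
    exact hi this
  have h0 := Measure.addHaar_submodule (volume : Measure (Space d)) (LinearMap.ker L) hker
  rw [ae_iff]
  have : {x : Space d | ¬ (dotProduct u (cvec x) + w ≠ 0)} =
      (fun x => x - x0) ⁻¹' (LinearMap.ker L : Set (Space d)) := by
    ext x
    simp only [not_not, Set.mem_ofPred_eq, Set.mem_preimage, SetLike.mem_coe, LinearMap.mem_ker,
      map_sub, hL, sub_eq_zero]
    constructor
    · intro hx
      exact add_right_cancel (hx.trans hx0.symm)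
    · intro hx
      rw [hx, hx0]
  rw [this]
  simpa [sub_eq_add_neg] using
    (measure_preimage_add_right volume (-x0) (LinearMap.ker L : Set (Space d))).trans h0

theorem firstOrderOp_pow_apply_of_fst_eq_zero {d : ℕ} (j : Fin d) (u : Fin d → ℂ) (w : ℂ) (N : ℕ)
    (φ : testFunctions d) (x : Space d) :
    ((firstOrderOp j (0, u, w) ^ N) φ).1 x = (dotProduct u (cvec x) + w) ^ N * φ.1 x := by
  induction N with
  | zero => simp
  | succ N ih =>
    rw [pow_succ', Module.End.mul_apply, firstOrderOp_apply, ih]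
    ring

theorem locallyIntegrable_mul_continuous {d : ℕ} {f h : Space d → ℂ}
    (hf : LocallyIntegrable f volume) (hh : Continuous h) :
    LocallyIntegrable (fun x => h x * f x) volume := by
  rw [← locallyIntegrableOn_univ] at *
  exact hf.continuousOn_mul hh.continuousOn isClosed_univ.isLocallyClosed

theorem ae_eq_zero_of_pairing_eq_zero {d : ℕ} {f : Space d → ℂ}
    (hf : LocallyIntegrable f volume) (h : ∀ φ : testFunctions d, ∫ x, f x * φ.1 x = 0) :
    f =ᵐ[volume] 0 := by
  refine ae_eq_zero_of_integral_contDiff_smul_eq_zero hf fun g hg hgs => ?_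
  have := h ⟨fun x => (g x : ℂ), Complex.ofRealCLM.contDiff.comp hg,
    hgs.comp_left (g := fun t : ℝ => (t : ℂ)) (by simp)⟩
  simpa [mul_comm] using this

/-- Without its derivative term the operator is multiplication by `u · x + w`, so the hypothesis
says that `(u · x + w) ^ N * f` vanishes as a distribution. -/
theorem ae_eq_zero_of_pairing_pow_eq_zero {d : ℕ} (j : Fin d) {f : Space d → ℂ}
    (hf : LocallyIntegrable f volume) {u : Fin d → ℂ} {w : ℂ} (huw : ¬ (u = 0 ∧ w = 0)) (N : ℕ)
    (h : ∀ φ, pairing f hf ((firstOrderOp j (0, u, w) ^ N) φ) = 0) : f =ᵐ[volume] 0 := by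
  have hc : Continuous fun x : Space d => (dotProduct u (cvec x) + w) ^ N := by
    have := continuous_cvec (d := d)
    fun_prop
  have := ae_eq_zero_of_pairing_eq_zero (locallyIntegrable_mul_continuous hf hc) fun φ => by
    rw [← h φ]
    simp only [pairing, LinearMap.coe_mk, AddHom.coe_mk, firstOrderOp_pow_apply_of_fst_eq_zero]
    congr 1; ext x; ring
  filter_upwards [this, ae_affine_ne_zero u w huw] with x hx hx'
  simpa [hx'] using hx

/-- If functions `P_k exp (-½ x · Q_k x + b_k · x)` converge in the sense of distributions along an
ultrafilter to a nonzero function, then `Q_k` and `b_k` converge along it. -/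
theorem exists_tendsto_phase {d : ℕ} {ι : Type*} (U : Ultrafilter ι) {ν : Fin d → ℕ}
    {P : ι → MvPolynomial (Fin d) ℂ} {Q : ι → Matrix (Fin d) (Fin d) ℂ} {b : ι → Fin d → ℂ}
    (hP : ∀ k, P k ∈ boxPolynomials ν) (hQ : ∀ k, (Q k).IsSymm) {f : Space d → ℂ}
    (hf : LocallyIntegrable f volume)
    (hlim : ∀ φ : testFunctions d, Tendsto (fun k => ∫ x, polyExp (P k) (Q k) (b k) x * φ.1 x) U
      (𝓝 (∫ x, f x * φ.1 x))) (hf0 : ¬ f =ᵐ[volume] 0) :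
    ∃ (Q' : Matrix (Fin d) (Fin d) ℂ) (b' : Fin d → ℂ), Tendsto Q U (𝓝 Q') ∧
      Tendsto b U (𝓝 b') := by
  have key : ∀ j, ∃ (u : Fin d → ℂ) (w : ℂ), Tendsto (fun k => Q k j) U (𝓝 u) ∧
      Tendsto (fun k => b k j) U (𝓝 w) := by
    intro j
    have hne : ∀ k, phaseCoeff j (Q k) (b k) ≠ 0 := fun k h => by
      simpa [phaseCoeff] using congrArg Prod.fst h
    obtain ⟨α, hα0, hα⟩ := exists_tendsto_normalize U (fun k => phaseCoeff j (Q k) (b k)) hne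
    have hzero : ∀ φ, pairing f hf ((firstOrderOp j α ^ (ν j + 1)) φ) = 0 := by
      intro φ
      have := tendsto_firstOrderOp_pow (l := (U : Filter ι)) j
        (Λ := fun k => pairing (polyExp (P k) (Q k) (b k))
          (continuous_polyExp _ _ _).locallyIntegrable)
        (Λ' := pairing f hf) hlim hα (ν j + 1) φ
      refine tendsto_nhds_unique this ?_
      simp only [pairing_firstOrderOp_pow_eq_zero j _ (hQ _) _ _ φ (Nat.lt_succ_of_le (hP _ j))]
      exact tendsto_const_nhds
    -- This is where the limit being nonzero enters: a limit operator of order zero would kill `f`.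
    have h1 : α.1 ≠ 0 := by
      intro h1
      refine hf0 (ae_eq_zero_of_pairing_pow_eq_zero j hf (u := α.2.1) (w := α.2.2) ?_ (ν j + 1) ?_)
      · rintro ⟨h2, h3⟩
        exact hα0 (Prod.ext h1 (Prod.ext h2 h3))
      · intro φ
        have := hzero φ
        rwa [show α = (0, α.2.1, α.2.2) from Prod.ext h1 rfl] at this
    -- Since the first entry of `phaseCoeff` is `1`, the first entry of the normalised vector is the
    -- inverse norm itself; its nonzero limit makes the norms converge.
    have hs : Tendsto (fun k => ((‖phaseCoeff j (Q k) (b k)‖ : ℂ)⁻¹)) U (𝓝 α.1) := by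
      refine ((continuous_fst.tendsto α).comp hα).congr fun k => ?_
      simp only [Function.comp_apply, Prod.smul_fst]
      simp only [phaseCoeff, smul_eq_mul, mul_one]
    have hβ : Tendsto (fun k => phaseCoeff j (Q k) (b k)) U (𝓝 (α.1⁻¹ • α)) := by
      refine ((hs.inv₀ h1).smul hα).congr fun k => ?_
      have := norm_ne_zero_iff.2 (hne k)
      rw [smul_smul, inv_mul_cancel₀ (inv_ne_zero (by exact_mod_cast this)), one_smul]
    refine ⟨-(α.1⁻¹ • α).2.1, (α.1⁻¹ • α).2.2, ?_, ?_⟩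
    · simpa [phaseCoeff, Function.comp_def] using
        (((continuous_fst.comp continuous_snd).neg).tendsto (α.1⁻¹ • α)).comp hβ
    · simpa [phaseCoeff, Function.comp_def] using
        (((continuous_snd.comp continuous_snd)).tendsto (α.1⁻¹ • α)).comp hβ
  choose Q' b' hQ' hb' using key
  exact ⟨Q', b', tendsto_pi_nhds.2 hQ', tendsto_pi_nhds.2 hb'⟩

/-! ### Coefficients of polynomials in the box, and their convergence -/

/-- The exponents of the monomials of degree at most `ν_j` in `x_j`. -/
noncomputable def boxIndex {d : ℕ} (ν : Fin d → ℕ) : Finset (Fin d →₀ ℕ) :=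
  Finset.Iic (Finsupp.equivFunOnFinite.symm ν)

/-- The polynomial with given coefficients on the box of exponents. -/
noncomputable def polyOfCoeff {d : ℕ} {ν : Fin d → ℕ} (c : boxIndex ν → ℂ) :
    MvPolynomial (Fin d) ℂ :=
  ∑ θ, MvPolynomial.monomial θ.1 (c θ)

theorem mem_boxIndex {d : ℕ} {ν : Fin d → ℕ} {θ : Fin d →₀ ℕ} :
    θ ∈ boxIndex ν ↔ ∀ j, θ j ≤ ν j := by
  simp [boxIndex, Finsupp.le_def]

theorem coeff_polyOfCoeff {d : ℕ} {ν : Fin d → ℕ} (c : boxIndex ν → ℂ) (θ : boxIndex ν) :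
    (polyOfCoeff c).coeff θ.1 = c θ := by
  classical
  simp only [polyOfCoeff, MvPolynomial.coeff_sum, MvPolynomial.coeff_monomial]
  rw [Finset.sum_eq_single θ (fun η _ h => if_neg fun h' => h (Subtype.ext h')) (by simp)]
  simp

theorem coeff_polyOfCoeff_of_notMem {d : ℕ} {ν : Fin d → ℕ} (c : boxIndex ν → ℂ)
    {θ : Fin d →₀ ℕ} (h : θ ∉ boxIndex ν) : (polyOfCoeff c).coeff θ = 0 := by
  classical
  simp only [polyOfCoeff, MvPolynomial.coeff_sum, MvPolynomial.coeff_monomial]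
  refine Finset.sum_eq_zero fun η _ => if_neg ?_
  rintro rfl
  exact h η.2

theorem polyOfCoeff_mem {d : ℕ} {ν : Fin d → ℕ} (c : boxIndex ν → ℂ) :
    polyOfCoeff c ∈ boxPolynomials ν := by
  intro j
  rw [MvPolynomial.degreeOf_le_iff]
  intro m hm
  by_contra h
  exact MvPolynomial.mem_support_iff.1 hm
    (coeff_polyOfCoeff_of_notMem c fun h' => h (mem_boxIndex.1 h' j))

theorem coeff_eq_zero_of_notMem_boxIndex {d : ℕ} {ν : Fin d → ℕ} {P : MvPolynomial (Fin d) ℂ}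
    (hP : P ∈ boxPolynomials ν) {θ : Fin d →₀ ℕ} (h : θ ∉ boxIndex ν) : P.coeff θ = 0 := by
  by_contra h0
  exact h (mem_boxIndex.2 fun j =>
    MvPolynomial.degreeOf_le_iff.1 (hP j) θ (MvPolynomial.mem_support_iff.2 h0))

theorem polyOfCoeff_coeff {d : ℕ} {ν : Fin d → ℕ} {P : MvPolynomial (Fin d) ℂ}
    (hP : P ∈ boxPolynomials ν) : polyOfCoeff (fun θ : boxIndex ν => P.coeff θ.1) = P := by
  ext θ
  by_cases h : θ ∈ boxIndex ν
  · exact coeff_polyOfCoeff _ ⟨θ, h⟩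
  · rw [coeff_polyOfCoeff_of_notMem _ h, coeff_eq_zero_of_notMem_boxIndex hP h]

theorem polyOfCoeff_smul {d : ℕ} {ν : Fin d → ℕ} (s : ℂ) (c : boxIndex ν → ℂ) :
    polyOfCoeff (s • c) = MvPolynomial.C s * polyOfCoeff c := by
  simp [polyOfCoeff, Finset.mul_sum, MvPolynomial.C_mul_monomial]

theorem eval_polyOfCoeff {d : ℕ} {ν : Fin d → ℕ} (c : boxIndex ν → ℂ) (y : Fin d → ℂ) :
    MvPolynomial.eval y (polyOfCoeff c) = ∑ θ, c θ * ∏ i, y i ^ θ.1 i := by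
  simp [polyOfCoeff, MvPolynomial.eval_monomial, Finsupp.prod_fintype]

theorem continuous_polyExp_param {d : ℕ} (ν : Fin d → ℕ) :
    Continuous fun z : ((boxIndex ν → ℂ) × Matrix (Fin d) (Fin d) ℂ × (Fin d → ℂ)) × Space d =>
      polyExp (polyOfCoeff z.1.1) z.1.2.1 z.1.2.2 z.2 := by
  have := continuous_cvec (d := d)
  simp only [polyExp, eval_polyOfCoeff, quadPhase]
  refine Continuous.mul ?_ (Continuous.cexp ?_)
  · unfold cvec; fun_prop
  · fun_prop

theorem tendsto_integral_polyExp {d : ℕ} {ι : Type*} {l : Filter ι} {ν : Fin d → ℕ}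
    {c : ι → boxIndex ν → ℂ} {Q : ι → Matrix (Fin d) (Fin d) ℂ} {b : ι → Fin d → ℂ}
    {c' : boxIndex ν → ℂ} {Q' : Matrix (Fin d) (Fin d) ℂ} {b' : Fin d → ℂ}
    (hc : Tendsto c l (𝓝 c')) (hQ : Tendsto Q l (𝓝 Q')) (hb : Tendsto b l (𝓝 b'))
    (φ : testFunctions d) :
    Tendsto (fun k => ∫ x, polyExp (polyOfCoeff (c k)) (Q k) (b k) x * φ.1 x) l
      (𝓝 (∫ x, polyExp (polyOfCoeff c') Q' b' x * φ.1 x)) := by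
  have hcont : Continuous fun z : (boxIndex ν → ℂ) × Matrix (Fin d) (Fin d) ℂ × (Fin d → ℂ) =>
      ∫ x, polyExp (polyOfCoeff z.1) z.2.1 z.2.2 x * φ.1 x := by
    rw [← continuousOn_univ]
    refine continuousOn_integral_of_compact_support (k := tsupport φ.1) φ.2.2 ?_ ?_
    · exact ((continuous_polyExp_param ν).mul
        (φ.2.1.continuous.comp continuous_snd)).continuousOn
    · intro z x _ hx
      rw [image_eq_zero_of_notMem_tsupport hx, mul_zero]
  have hz : Tendsto (fun k => (c k, Q k, b k)) l (𝓝 (c', Q', b')) :=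
    hc.prodMk_nhds (hQ.prodMk_nhds hb)
  have h1 := Tendsto.comp (hcont.tendsto (c', Q', b')) hz
  simp only [Function.comp_def] at h1
  exact h1

/-- The real points form a product of infinite subsets of `ℂ`, and such a product determines a
complex polynomial. -/
theorem eq_of_eval_cvec_eq {d : ℕ} {P P' : MvPolynomial (Fin d) ℂ}
    (h : ∀ x : Space d, MvPolynomial.eval (cvec x) P = MvPolynomial.eval (cvec x) P') :
    P = P' := by
  refine MvPolynomial.funext_set (fun _ => Set.range ((↑) : ℝ → ℂ))
    (fun _ => Set.infinite_range_of_injective Complex.ofReal_injective) fun y hy => ?_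
  choose x hx using fun i => hy i (Set.mem_univ i)
  have : y = cvec (WithLp.toLp 2 x) := by
    ext i; simp [cvec, hx]
  rw [this]
  exact h _

theorem eq_zero_of_polyExp_eq_zero {d : ℕ} {P : MvPolynomial (Fin d) ℂ}
    {Q : Matrix (Fin d) (Fin d) ℂ} {b : Fin d → ℂ} (h : ∀ x, polyExp P Q b x = 0) : P = 0 :=
  eq_of_eval_cvec_eq fun x => by simpa [polyExp] using h x

theorem polyExp_C_mul {d : ℕ} (s : ℂ) (P : MvPolynomial (Fin d) ℂ)
    (Q : Matrix (Fin d) (Fin d) ℂ) (b : Fin d → ℂ) (x : Space d) :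
    polyExp (MvPolynomial.C s * P) Q b x = s * polyExp P Q b x := by
  simp [polyExp, mul_assoc]

/-- The rescaled functions have two descriptions of their limit: `α.1 * f`, and the function built
from the limit of the rescaled coefficients. Comparing them identifies `f` once `α.1 ≠ 0`. -/
theorem exists_tendsto_coeff {d : ℕ} {ι : Type*} (U : Ultrafilter ι) {ν : Fin d → ℕ}
    {P : ι → MvPolynomial (Fin d) ℂ} {Q : ι → Matrix (Fin d) (Fin d) ℂ} {b : ι → Fin d → ℂ}
    {Q' : Matrix (Fin d) (Fin d) ℂ} {b' : Fin d → ℂ} (hP : ∀ k, P k ∈ boxPolynomials ν)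
    (hQ : Tendsto Q U (𝓝 Q')) (hb : Tendsto b U (𝓝 b')) {f : Space d → ℂ}
    (hf : LocallyIntegrable f volume)
    (hlim : ∀ φ : testFunctions d, Tendsto (fun k => ∫ x, polyExp (P k) (Q k) (b k) x * φ.1 x) U
      (𝓝 (∫ x, f x * φ.1 x))) :
    ∃ P' ∈ boxPolynomials ν, (∀ θ, Tendsto (fun k => (P k).coeff θ) U (𝓝 (P'.coeff θ))) ∧
      f =ᵐ[volume] polyExp P' Q' b' := by
  let c : ι → boxIndex ν → ℂ := fun k θ => (P k).coeff θ.1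
  have hPc : ∀ k, polyOfCoeff (c k) = P k := fun k => polyOfCoeff_coeff (hP k)
  -- The leading `1` keeps the vector nonzero even if `P k = 0`, and records the normalising factor.
  let β : ι → ℂ × (boxIndex ν → ℂ) := fun k => (1, c k)
  have hne : ∀ k, β k ≠ 0 := fun k h => by simpa [β] using congrArg Prod.fst h
  obtain ⟨α, hα0, hα⟩ := exists_tendsto_normalize U β hne
  set s : ι → ℂ := fun k => (‖β k‖ : ℂ)⁻¹
  have hs : Tendsto s U (𝓝 α.1) := by
    refine ((continuous_fst.tendsto α).comp hα).congr fun k => ?_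
    simp [β, s]
  have hsc : Tendsto (fun k => s k • c k) U (𝓝 α.2) := (continuous_snd.tendsto α).comp hα
  have hae : (fun x => α.1 * f x) =ᵐ[volume] polyExp (polyOfCoeff α.2) Q' b' := by
    have hl := locallyIntegrable_mul_continuous hf (continuous_const (y := α.1))
    have hr := (continuous_polyExp (polyOfCoeff α.2) Q' b').locallyIntegrable (μ := volume)
    have := ae_eq_zero_of_pairing_eq_zero (hl.sub hr) fun φ => by
      have e : ∀ x, (((fun x => α.1 * f x) - polyExp (polyOfCoeff α.2) Q' b') x) * φ.1 x =
          (α.1 * f x) * φ.1 x - polyExp (polyOfCoeff α.2) Q' b' x * φ.1 x := fun x => by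
        simp [sub_mul]
      simp_rw [e]
      rw [integral_sub (integrable_mul_test hl φ) (integrable_mul_test hr φ), sub_eq_zero]
      have h1 := hs.mul (hlim φ)
      refine tendsto_nhds_unique ?_ (tendsto_integral_polyExp hsc hQ hb φ)
      convert h1 using 2 with k
      · simp_rw [polyOfCoeff_smul, polyExp_C_mul, hPc, mul_assoc]
        rw [integral_const_mul]
      · simp_rw [mul_assoc]
        rw [integral_const_mul]
    filter_upwards [this] with x hx
    exact sub_eq_zero.1 hx
  -- If `α.1 = 0`, the limit polynomial times a nonvanishing exponential is zero, so `α.2 = 0` too,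
  -- contradicting `α ≠ 0`.
  have h1 : α.1 ≠ 0 := by
    intro h1
    refine hα0 (Prod.ext h1 ?_)
    have h0 : polyExp (polyOfCoeff α.2) Q' b' = fun _ => 0 := by
      refine (Continuous.ae_eq_iff_eq volume (continuous_polyExp _ _ _) continuous_const).1 ?_
      filter_upwards [hae] with x hx
      rw [← hx, h1, zero_mul]
    have hz := eq_zero_of_polyExp_eq_zero (congrFun h0)
    ext θ
    rw [← coeff_polyOfCoeff α.2 θ, hz]
    simp
  have hc : Tendsto c U (𝓝 (α.1⁻¹ • α.2)) := by
    refine ((hs.inv₀ h1).smul hsc).congr fun k => ?_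
    have := norm_ne_zero_iff.2 (hne k)
    rw [smul_smul, inv_mul_cancel₀ (inv_ne_zero (by exact_mod_cast this)), one_smul]
  refine ⟨polyOfCoeff (α.1⁻¹ • α.2), polyOfCoeff_mem _, fun θ => ?_, ?_⟩
  · by_cases h : θ ∈ boxIndex ν
    · rw [coeff_polyOfCoeff _ ⟨θ, h⟩]
      exact (tendsto_pi_nhds.1 hc ⟨θ, h⟩)
    · simp only [coeff_polyOfCoeff_of_notMem _ h, coeff_eq_zero_of_notMem_boxIndex (hP _) h]
      exact tendsto_const_nhds
  · filter_upwards [hae] with x hx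
    rw [polyOfCoeff_smul, polyExp_C_mul, ← hx, inv_mul_cancel_left₀ h1]

/-! ### Uniqueness of the parameters -/

theorem totalDegree_pderiv_lt {d : ℕ} (j : Fin d) {P : MvPolynomial (Fin d) ℂ}
    (h : MvPolynomial.pderiv j P ≠ 0) :
    (MvPolynomial.pderiv j P).totalDegree < P.totalDegree := by
  have key : ∀ m ∈ (MvPolynomial.pderiv j P).support, (m.sum fun _ e => e) < P.totalDegree := by
    intro m hm
    rw [MvPolynomial.mem_support_iff, MvPolynomial.coeff_pderiv] at hm
    have h : m + Finsupp.single j 1 ∈ P.support := by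
      rw [MvPolynomial.mem_support_iff]
      intro h0
      simp [h0] at hm
    have := MvPolynomial.le_totalDegree h
    rw [Finsupp.sum_add_index' (by simp) (by simp), Finsupp.sum_single_index rfl] at this
    omega
  obtain ⟨m, hm⟩ := MvPolynomial.support_nonempty.2 h
  rw [MvPolynomial.totalDegree]
  exact (Finset.sup_lt_iff ((Nat.zero_le _).trans_lt (key m hm))).2 key

/-- Differentiation lowers the total degree, so a nonzero left side has degree below `deg P + deg
P'`, whereas a nonzero right side has at least that degree. -/
theorem eq_zero_of_pderiv_mul_sub_eq {d : ℕ} (j : Fin d) {P P' L : MvPolynomial (Fin d) ℂ}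
    (hP : P ≠ 0) (hP' : P' ≠ 0)
    (h : MvPolynomial.pderiv j P * P' - MvPolynomial.pderiv j P' * P = L * (P * P')) :
    L = 0 := by
  by_contra hL
  have hne : L * (P * P') ≠ 0 := mul_ne_zero hL (mul_ne_zero hP hP')
  have hdeg : P.totalDegree + P'.totalDegree ≤ (L * (P * P')).totalDegree := by
    rw [MvPolynomial.totalDegree_mul_of_isDomain hL (mul_ne_zero hP hP'),
      MvPolynomial.totalDegree_mul_of_isDomain hP hP']
    omega
  have aux : ∀ R R' : MvPolynomial (Fin d) ℂ, MvPolynomial.pderiv j R * R' ≠ 0 →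
      (MvPolynomial.pderiv j R * R').totalDegree < R.totalDegree + R'.totalDegree := by
    intro R R' h
    have := totalDegree_pderiv_lt j (left_ne_zero_of_mul h)
    have := MvPolynomial.totalDegree_mul (MvPolynomial.pderiv j R) R'
    omega
  rw [← h] at hdeg hne
  by_cases h1 : MvPolynomial.pderiv j P * P' = 0
  · have h2 : MvPolynomial.pderiv j P' * P ≠ 0 := by
      intro h2
      simp [h1, h2] at hne
    have := aux _ _ h2
    rw [h1, zero_sub, MvPolynomial.totalDegree_neg] at hdeg
    omega
  · have h1' := aux _ _ h1
    by_cases h2 : MvPolynomial.pderiv j P' * P = 0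
    · rw [h2, sub_zero] at hdeg
      omega
    · have h2' := aux _ _ h2
      have := MvPolynomial.totalDegree_sub (MvPolynomial.pderiv j P * P')
        (MvPolynomial.pderiv j P' * P)
      omega

/-- Comparing logarithmic derivatives in direction `j` gives a polynomial identity with `L` the
difference of the two affine phase derivatives. The degree count forces `L = 0`; its values at `0`
and at the basis vectors give `b` and `Q`. -/
theorem polyExp_injective {d : ℕ} {P P' : MvPolynomial (Fin d) ℂ}
    {Q Q' : Matrix (Fin d) (Fin d) ℂ} {b b' : Fin d → ℂ} (hQ : Q.IsSymm) (hQ' : Q'.IsSymm)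
    (hP : P ≠ 0) (h : polyExp P Q b = polyExp P' Q' b') : P = P' ∧ Q = Q' ∧ b = b' := by
  have hP' : P' ≠ 0 := by
    rintro rfl
    exact hP (eq_zero_of_polyExp_eq_zero fun x => by rw [h]; simp [polyExp])
  have key : ∀ j, b j = b' j ∧ ∀ i, Q j i = Q' j i := by
    intro j
    let L : MvPolynomial (Fin d) ℂ := MvPolynomial.C (b' j - b j) +
      ∑ i, MvPolynomial.C (Q j i - Q' j i) * MvPolynomial.X i
    have hLe : ∀ y, MvPolynomial.eval y L = (b' j - Q'.mulVec y j) - (b j - Q.mulVec y j) := by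
      intro y
      simp only [L, map_add, map_sum, map_mul, MvPolynomial.eval_C, MvPolynomial.eval_X,
        sub_mul, Finset.sum_sub_distrib, Matrix.mulVec, dotProduct]
      ring
    have hL : L = 0 := by
      refine eq_zero_of_pderiv_mul_sub_eq j hP hP' (eq_of_eval_cvec_eq fun x => ?_)
      have h1 := hasLineDerivAt_polyExp P hQ b x j
      have h2 := hasLineDerivAt_polyExp P' hQ' b' x j
      rw [h] at h1
      have h3 := HasDerivAt.unique h1 h2
      have h4 := congrFun h x
      simp only [polyExp] at h3 h4
      simp only [map_sub, map_mul, hLe]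
      refine mul_right_cancel₀ (Complex.exp_ne_zero (quadPhase Q b x)) ?_
      -- The equality `h4` of the two functions is used to replace the second exponential by the
      -- first.
      linear_combination (MvPolynomial.eval (cvec x) P') * h3 +
        (MvPolynomial.eval (cvec x) (MvPolynomial.pderiv j P') +
          (b' j - Q'.mulVec (cvec x) j) * MvPolynomial.eval (cvec x) P' ) * (-h4)
          + (b j - Q.mulVec (cvec x) j) * MvPolynomial.eval (cvec x) P' * h4
    have h0 := hLe 0
    simp only [hL, map_zero, Matrix.mulVec_zero, Pi.zero_apply, sub_zero] at h0
    have hb : b' j = b j := sub_eq_zero.1 h0.symm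
    refine ⟨hb.symm, fun i => ?_⟩
    have hi := hLe (Pi.single i 1)
    simp only [hL, map_zero, hb, Matrix.mulVec_single_one, Matrix.col_apply] at hi
    linear_combination -hi
  have hb : b = b' := funext fun j => (key j).1
  have hQQ : Q = Q' := Matrix.ext fun j i => (key j).2 i
  refine ⟨eq_of_eval_cvec_eq fun x => ?_, hQQ, hb⟩
  subst hb hQQ
  exact mul_right_cancel₀ (Complex.exp_ne_zero _) (congrFun h x)

/-! ### Integrability forces a positive definite real part -/

theorem re_dotProduct_mulVec_cvec {d : ℕ} (Q : Matrix (Fin d) (Fin d) ℂ) (v x : Space d) :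
    (dotProduct (cvec v) (Q.mulVec (cvec x))).re =
      dotProduct v.ofLp ((Q.map Complex.re).mulVec x.ofLp) := by
  simp [dotProduct, Matrix.mulVec, cvec]

theorem re_dotProduct_cvec {d : ℕ} (b : Fin d → ℂ) (x : Space d) :
    (dotProduct b (cvec x)).re = dotProduct (fun i => (b i).re) x.ofLp := by
  simp [dotProduct, cvec]

/-- The balls of radius `ε` around `x₀ + n v` are disjoint because `2 * ε ≤ ‖v‖`. Hence the sum of
all translates of `G` has finite integral over the first ball; the series is finite almost
everywhere and its terms tend to zero. -/
theorem ae_tendsto_translate_zero {d : ℕ} {G : Space d → ℝ≥0∞} (hG : Measurable G)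
    (hfin : ∫⁻ x, G x ≠ ⊤) (x₀ v : Space d) {ε : ℝ} (hε : 2 * ε ≤ ‖v‖) :
    ∀ᵐ x ∂(volume.restrict (Metric.ball x₀ ε)),
      Tendsto (fun n : ℕ => G (x + (n : ℝ) • v)) atTop (𝓝 0) := by
  have hmeas : ∀ n : ℕ, Measurable fun x => G (x + (n : ℝ) • v) := fun n =>
    hG.comp (measurable_id.add_const _)
  have hdisj : Pairwise (Function.onFun Disjoint
      fun n : ℕ => Metric.ball (x₀ + (n : ℝ) • v) ε) := by
    intro m n hmn
    refine Metric.ball_disjoint_ball ?_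
    rw [dist_add_left, dist_eq_norm, ← sub_smul, norm_smul, ← two_mul]
    have : (1 : ℝ) ≤ ‖(m : ℝ) - n‖ := by
      rw [Real.norm_eq_abs]
      have h1 : (1 : ℤ) ≤ |(m : ℤ) - n| := Int.one_le_abs (by omega)
      exact_mod_cast h1
    nlinarith [norm_nonneg v]
  have hle : ∫⁻ x in Metric.ball x₀ ε, ∑' n : ℕ, G (x + (n : ℝ) • v) ≤ ∫⁻ x, G x := by
    rw [lintegral_tsum fun n => (hmeas n).aemeasurable]
    have : ∀ n : ℕ, ∫⁻ x in Metric.ball x₀ ε, G (x + (n : ℝ) • v) =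
        ∫⁻ x in Metric.ball (x₀ + (n : ℝ) • v) ε, G x := by
      intro n
      rw [← (measurePreserving_add_right volume ((n : ℝ) • v)).setLIntegral_comp_preimage
        measurableSet_ball hG]
      congr 2
      ext x
      simp
    simp_rw [this]
    rw [← lintegral_iUnion (fun _ => measurableSet_ball) hdisj]
    exact setLIntegral_le_lintegral _ _
  have hae := ae_lt_top (Measurable.tsum hmeas)
    (ne_top_of_le_ne_top hfin hle)
  filter_upwards [hae] with x hx
  exact ENNReal.tendsto_atTop_zero_of_tsum_ne_top hx.ne

theorem eval_aeval_line {σ : Type*} (y w : σ → ℂ) (t : ℂ) (P : MvPolynomial σ ℂ) :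
    (MvPolynomial.aeval (fun i => Polynomial.C (y i) + Polynomial.C (w i) * Polynomial.X) P).eval t =
      MvPolynomial.eval (y + t • w) P := by
  induction P using MvPolynomial.induction_on with
  | C a => simp
  | add p q hp hq => simp [hp, hq]
  | mul_X p i hp => simp [hp, mul_comm t]

/-- On a line the polynomial is either constant, equal to its nonzero value at `x`, or of positive
degree and unbounded. -/
theorem not_tendsto_eval_line {d : ℕ} {P : MvPolynomial (Fin d) ℂ} {x v : Space d}
    (hP : MvPolynomial.eval (cvec x) P ≠ 0) :
    ¬ Tendsto (fun n : ℕ => MvPolynomial.eval (cvec (x + (n : ℝ) • v)) P) atTop (𝓝 0) := by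
  intro h
  let p : Polynomial ℂ := MvPolynomial.aeval
    (fun i => Polynomial.C (cvec x i) + Polynomial.C (cvec v i) * Polynomial.X) P
  have hp : ∀ t : ℝ, MvPolynomial.eval (cvec (x + t • v)) P = p.eval (t : ℂ) := by
    intro t
    rw [eval_aeval_line, cvec_add_smul]
  simp only [hp] at h
  by_cases hd : 0 < p.degree
  · have ht := p.tendsto_norm_atTop hd (l := atTop) (z := fun n : ℕ => ((n : ℝ) : ℂ))
      (by simpa using tendsto_natCast_atTop_atTop (R := ℝ))
    exact not_tendsto_nhds_of_tendsto_atTop ht _ h.norm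
  · rw [Polynomial.eq_C_of_degree_le_zero (not_lt.1 hd)] at h
    simp only [Polynomial.eval_C] at h
    have h0 := tendsto_nhds_unique h tendsto_const_nhds
    refine hP ?_
    have := hp 0
    rw [Polynomial.eq_C_of_degree_le_zero (not_lt.1 hd), Polynomial.eval_C, ← h0] at this
    simpa using this

/-- If a nonzero function `P exp (-½ x · Q x + b · x)` with `Re Q ≥ 0` has finite `L^r` norm for some
`r < ∞`, then `Re Q` is positive definite. -/
theorem posDef_of_eLpNorm_lt_top {d : ℕ} {P : MvPolynomial (Fin d) ℂ}
    {Q : Matrix (Fin d) (Fin d) ℂ} {b : Fin d → ℂ} (hQ : Q.IsSymm)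
    (hA : (Q.map Complex.re).PosSemidef) (hP : P ≠ 0) {r : ℝ≥0∞} (hr0 : r ≠ 0) (hr : r ≠ ⊤)
    (h : eLpNorm (polyExp P Q b) r volume < ⊤) : (Q.map Complex.re).PosDef := by
  refine Matrix.PosDef.of_dotProduct_mulVec_pos hA.1 fun w hw => ?_
  refine lt_of_le_of_ne (hA.dotProduct_mulVec_nonneg w) fun h0 => ?_
  have hAw := (hA.dotProduct_mulVec_zero_iff w).1 h0.symm
  obtain ⟨v, hv0, hAv, hbv⟩ : ∃ v : Space d, v ≠ 0 ∧ (Q.map Complex.re).mulVec v.ofLp = 0 ∧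
      0 ≤ (dotProduct b (cvec v)).re := by
    -- The kernel direction is fixed up to sign; the sign is chosen so that the linear part of the
    -- phase does not decay.
    rcases le_total 0 (dotProduct b (cvec (WithLp.toLp 2 w))).re with hle | hle
    · exact ⟨WithLp.toLp 2 w, by simpa using hw, hAw, hle⟩
    · refine ⟨WithLp.toLp 2 (-w), by simpa using hw, by simp [Matrix.mulVec_neg, hAw], ?_⟩
      rw [re_dotProduct_cvec] at hle ⊢
      simpa using hle
  -- Along `v` the quadratic and cross terms have zero real part, since `Re Q` is symmetric and
  -- kills `v`; so the modulus of the exponential does not decrease.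
  have hre : ∀ (x : Space d) (n : ℕ), (quadPhase Q b x).re ≤
      (quadPhase Q b (x + (n : ℝ) • v)).re := by
    intro x n
    have e1 : (dotProduct (cvec v) (Q.mulVec (cvec x))).re = 0 := by
      rw [re_dotProduct_mulVec_cvec, Matrix.dotProduct_mulVec, ← Matrix.mulVec_transpose,
        ← Matrix.transpose_map, hQ.eq, hAv, zero_dotProduct]
    have e2 : (dotProduct (cvec v) (Q.mulVec (cvec v))).re = 0 := by
      rw [re_dotProduct_mulVec_cvec, hAv, dotProduct_zero]
    rw [quadPhase_add_smul hQ]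
    have e3 : ((1 / 2 : ℂ) * ((n : ℝ) : ℂ) ^ 2) = (((1 / 2 : ℝ) * (n : ℝ) ^ 2 : ℝ) : ℂ) := by
      push_cast; ring
    rw [e3, Complex.sub_re, Complex.add_re, Complex.re_ofReal_mul, Complex.re_ofReal_mul,
      Complex.sub_re, e1, e2]
    have : 0 ≤ (n : ℝ) * (dotProduct b (cvec v)).re := by positivity
    linarith
  obtain ⟨x₀, hx₀⟩ : ∃ x₀ : Space d, MvPolynomial.eval (cvec x₀) P ≠ 0 := by
    by_contra! hc
    exact hP (eq_of_eval_cvec_eq fun x => by simpa using hc x)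
  obtain ⟨ε₁, hε₁, hball⟩ := Metric.isOpen_iff.1
    ((continuous_eval_cvec P).isOpen_preimage _ isOpen_compl_singleton) x₀ hx₀
  have hvpos := norm_pos_iff.2 hv0
  -- The radius `ε₁` keeps `P` nonzero on the ball, and `‖v‖ / 2` keeps the translated balls
  -- disjoint.
  set ε := min ε₁ (‖v‖ / 2)
  have hε : 0 < ε := lt_min hε₁ (by positivity)
  have hfin := lintegral_rpow_enorm_lt_top_of_eLpNorm_lt_top hr0 hr h
  have hr' : 0 < r.toReal := ENNReal.toReal_pos hr0 hr
  have hae := ae_tendsto_translate_zero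
    ((continuous_polyExp P Q b).measurable.enorm.pow_const r.toReal) hfin.ne x₀ v (ε := ε)
    (by linarith [min_le_right ε₁ (‖v‖ / 2)])
  have hne : NeBot (ae (volume.restrict (Metric.ball x₀ ε))) :=
    ae_restrict_neBot.2 (Metric.measure_ball_pos volume x₀ hε).ne'
  obtain ⟨x, hx, hxb⟩ := (hae.and (ae_restrict_mem measurableSet_ball)).exists
  have hPx : MvPolynomial.eval (cvec x) P ≠ 0 :=
    hball (Metric.ball_subset_ball (min_le_left _ _) hxb)
  refine not_tendsto_eval_line (v := v) hPx ?_
  have h1 : Tendsto (fun n : ℕ => ‖polyExp P Q b (x + (n : ℝ) • v)‖ₑ) atTop (𝓝 0) := by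
    have := hx.ennrpow_const (1 / r.toReal)
    simpa [← ENNReal.rpow_mul, hr'.ne', ENNReal.zero_rpow_of_pos (inv_pos.2 hr')] using this
  have h2 : Tendsto (fun n : ℕ => ‖polyExp P Q b (x + (n : ℝ) • v)‖) atTop (𝓝 0) := by
    have := (ENNReal.tendsto_toReal ENNReal.zero_ne_top).comp h1
    simpa [Function.comp_def] using this
  -- Dividing by the modulus of the exponential at `x` leaves a bound on `P` alone, which would have
  -- to tend to zero along the line.
  have h3 := h2.mul_const (Real.exp (-(quadPhase Q b x).re))
  rw [zero_mul] at h3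
  refine squeeze_zero_norm (fun n => ?_) h3
  rw [polyExp, norm_mul, Complex.norm_exp, mul_assoc, ← Real.exp_add]
  refine le_mul_of_one_le_right (norm_nonneg _) (Real.one_le_exp ?_)
  linarith [hre x n]

/-! ### Gaussian bounds and convergence in every `L^s` -/

/-- Mean value inequality on the convex half-plane `Re ≤ m`, where the derivative of `exp` is
bounded by `exp m`. -/
theorem norm_cexp_sub_cexp_le {z w : ℂ} {m : ℝ} (hz : z.re ≤ m) (hw : w.re ≤ m) :
    ‖Complex.exp z - Complex.exp w‖ ≤ Real.exp m * ‖z - w‖ := by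
  refine Convex.norm_image_sub_le_of_norm_deriv_le (s := {z : ℂ | z.re ≤ m})
    (fun x _ => Complex.differentiableAt_exp) (fun x hx => ?_) (convex_halfSpace_re_le m) hw hz
  rw [Complex.deriv_exp, Complex.norm_exp]
  exact Real.exp_le_exp.2 hx

theorem exists_pow_mul_exp_le (N : ℕ) {a : ℝ} (ha : 0 < a) (c : ℝ) :
    ∃ K, 0 < K ∧ ∀ t : ℝ, 0 ≤ t → (1 + t) ^ N * Real.exp (-a * t ^ 2 + c * t) ≤ K := by
  -- The power is absorbed by `(1 + t) ^ N ≤ N! exp (1 + t)`; the quotient is the maximum of `-a t²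
  -- + (c + 1) t`, found by completing the square.
  refine ⟨N.factorial * Real.exp ((c + 1) ^ 2 / (4 * a) + 1), by positivity, fun t ht => ?_⟩
  have h1 : (1 + t) ^ N ≤ N.factorial * Real.exp (1 + t) := by
    have := Real.pow_div_factorial_le_exp (1 + t) (by linarith) N
    rwa [div_le_iff₀' (by positivity)] at this
  have h2 : 1 + t + (-a * t ^ 2 + c * t) ≤ (c + 1) ^ 2 / (4 * a) + 1 := by
    have : (c + 1) ^ 2 / (4 * a) - (-a * t ^ 2 + (c + 1) * t) = (2 * a * t - (c + 1)) ^ 2 / (4 * a) := by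
      field_simp; ring
    have h3 : 0 ≤ (2 * a * t - (c + 1)) ^ 2 / (4 * a) := by positivity
    linarith
  calc (1 + t) ^ N * Real.exp (-a * t ^ 2 + c * t)
      ≤ (N.factorial * Real.exp (1 + t)) * Real.exp (-a * t ^ 2 + c * t) := by gcongr
    _ = N.factorial * Real.exp (1 + t + (-a * t ^ 2 + c * t)) := by
        rw [mul_assoc, ← Real.exp_add]
    _ ≤ _ := by gcongr

/-- Minimum of the quadratic form on the compact unit sphere, extended by homogeneity. -/
theorem exists_coercive {d : ℕ} {A : Matrix (Fin d) (Fin d) ℝ} (hA : A.PosDef) :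
    ∃ δ, 0 < δ ∧ ∀ x : Space d, δ * ‖x‖ ^ 2 ≤ dotProduct x.ofLp (A.mulVec x.ofLp) := by
  have hc : Continuous fun x : Space d => dotProduct x.ofLp (A.mulVec x.ofLp) := by
    fun_prop
  obtain ⟨δ, hδ, h⟩ := (isCompact_sphere (0 : Space d) 1).exists_forall_le' hc.continuousOn
    (a := 0) (fun x hx => by
      have hx0 : x.ofLp ≠ 0 := by
        intro h0
        have : x = 0 := by ext i; simp [h0]
        simp [this] at hx
      simpa using hA.dotProduct_mulVec_pos hx0)
  refine ⟨δ, hδ, fun x => ?_⟩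
  rcases eq_or_ne x 0 with rfl | hx
  · simp
  have hn := norm_ne_zero_iff.2 hx
  have := h (‖x‖⁻¹ • x) (by simp [norm_smul, hn])
  simp only [WithLp.ofLp_smul, Matrix.mulVec_smul, dotProduct_smul, smul_dotProduct,
    smul_eq_mul] at this
  field_simp at this
  linarith

theorem norm_cvec_le {d : ℕ} (x : Space d) (i : Fin d) : ‖cvec x i‖ ≤ ‖x‖ := by
  simpa [cvec] using PiLp.norm_apply_le x i

theorem norm_dotProduct_cvec_le {d : ℕ} (b : Fin d → ℂ) (x : Space d) :
    ‖dotProduct b (cvec x)‖ ≤ (∑ i, ‖b i‖) * ‖x‖ := by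
  rw [dotProduct, Finset.sum_mul]
  refine (norm_sum_le _ _).trans (Finset.sum_le_sum fun i _ => ?_)
  rw [norm_mul]
  gcongr
  exact norm_cvec_le x i

theorem norm_dotProduct_mulVec_cvec_le {d : ℕ} (Q : Matrix (Fin d) (Fin d) ℂ) (x : Space d) :
    ‖dotProduct (cvec x) (Q.mulVec (cvec x))‖ ≤ (∑ i, ∑ j, ‖Q i j‖) * ‖x‖ ^ 2 := by
  rw [dotProduct, Finset.sum_mul]
  refine (norm_sum_le _ _).trans (Finset.sum_le_sum fun i _ => ?_)
  rw [norm_mul]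
  calc ‖cvec x i‖ * ‖Q.mulVec (cvec x) i‖ ≤ ‖x‖ * ((∑ j, ‖Q i j‖) * ‖x‖) := by
        gcongr
        · exact norm_cvec_le x i
        · exact norm_dotProduct_cvec_le (Q i) x
    _ = _ := by ring

theorem quadPhase_sub {d : ℕ} (Q Q' : Matrix (Fin d) (Fin d) ℂ) (b b' : Fin d → ℂ) (x : Space d) :
    quadPhase Q b x - quadPhase Q' b' x = quadPhase (Q - Q') (b - b') x := by
  simp only [quadPhase, Matrix.sub_mulVec, dotProduct_sub, sub_dotProduct]
  ring

theorem norm_quadPhase_le {d : ℕ} (Q : Matrix (Fin d) (Fin d) ℂ) (b : Fin d → ℂ) (x : Space d) :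
    ‖quadPhase Q b x‖ ≤ (∑ i, ∑ j, ‖Q i j‖) * ‖x‖ ^ 2 + (∑ i, ‖b i‖) * ‖x‖ := by
  refine (norm_add_le _ _).trans (add_le_add ?_ (norm_dotProduct_cvec_le b x))
  rw [norm_mul]
  refine le_trans ?_ (norm_dotProduct_mulVec_cvec_le Q x)
  refine mul_le_of_le_one_left (norm_nonneg _) ?_
  norm_num

theorem norm_eval_polyOfCoeff_le {d : ℕ} {ν : Fin d → ℕ} (c : boxIndex ν → ℂ) (x : Space d) :
    ‖MvPolynomial.eval (cvec x) (polyOfCoeff c)‖ ≤ (∑ θ, ‖c θ‖) * (1 + ‖x‖) ^ (∑ i, ν i) := by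
  rw [eval_polyOfCoeff, Finset.sum_mul]
  refine (norm_sum_le _ _).trans (Finset.sum_le_sum fun θ _ => ?_)
  rw [norm_mul, norm_prod, ← Finset.prod_pow_eq_pow_sum]
  gcongr with i
  rw [norm_pow]
  calc ‖cvec x i‖ ^ θ.1 i ≤ (1 + ‖x‖) ^ θ.1 i := by
        gcongr
        linarith [norm_cvec_le x i]
    _ ≤ (1 + ‖x‖) ^ ν i :=
        pow_le_pow_right₀ (by linarith [norm_nonneg x]) (mem_boxIndex.1 θ.2 i)

theorem polyOfCoeff_sub {d : ℕ} {ν : Fin d → ℕ} (c c' : boxIndex ν → ℂ) :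
    polyOfCoeff c - polyOfCoeff c' = polyOfCoeff (c - c') := by
  simp [polyOfCoeff, Finset.sum_sub_distrib]

theorem eLpNorm_inv_one_add_norm_pow_ne_top (d : ℕ) {s : ℝ≥0∞} (hs : 1 ≤ s) :
    eLpNorm (fun x : Space d => ((1 + ‖x‖) ^ (d + 1))⁻¹) s volume ≠ ⊤ := by
  have hb : ∀ x : Space d, ‖((1 + ‖x‖) ^ (d + 1))⁻¹‖ ≤ 1 := fun x => by
    rw [Real.norm_of_nonneg (by positivity)]
    exact inv_le_one_of_one_le₀ (one_le_pow₀ (by linarith [norm_nonneg x]))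
  rcases eq_or_ne s ⊤ with rfl | hs'
  · exact (eLpNormEssSup_lt_top_of_ae_bound (Eventually.of_forall hb)).ne
  have h1 : Integrable (fun x : Space d => ((1 + ‖x‖) ^ (d + 1))⁻¹) volume := by
    have := integrable_one_add_norm (E := Space d) (μ := volume) (r := (d + 1 : ℕ))
      (by simp)
    refine this.congr (Eventually.of_forall fun x => ?_)
    simp only
    rw [Real.rpow_neg (by positivity), Real.rpow_natCast]
  have hs0 : s ≠ 0 := (zero_lt_one.trans_le hs).ne'
  refine ((eLpNorm_lt_top_iff_lintegral_rpow_enorm_lt_top hs0 hs').2 ?_).ne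
  refine lt_of_le_of_lt (lintegral_mono fun x => ?_) h1.2
  refine ENNReal.rpow_le_self_of_le_one ?_ ?_
  · rw [← ofReal_norm]
    exact ENNReal.ofReal_le_one.2 (hb x)
  · rwa [← ENNReal.toReal_one, ENNReal.toReal_le_toReal ENNReal.one_ne_top hs']

/-- Convergence of the parameters to parameters with `Re Q` positive definite implies convergence
in every `L^s`. -/
theorem tendsto_eLpNorm_polyExp {d : ℕ} {ι : Type*} {l : Filter ι} {ν : Fin d → ℕ}
    {c : ι → boxIndex ν → ℂ} {Q : ι → Matrix (Fin d) (Fin d) ℂ} {b : ι → Fin d → ℂ}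
    {c' : boxIndex ν → ℂ} {Q' : Matrix (Fin d) (Fin d) ℂ} {b' : Fin d → ℂ}
    (hc : Tendsto c l (𝓝 c')) (hQ : Tendsto Q l (𝓝 Q')) (hb : Tendsto b l (𝓝 b'))
    (hA : (Q'.map Complex.re).PosDef) {s : ℝ≥0∞} (hs : 1 ≤ s) :
    Tendsto (fun k => eLpNorm (fun x => polyExp (polyOfCoeff (c k)) (Q k) (b k) x -
      polyExp (polyOfCoeff c') Q' b' x) s volume) l (𝓝 0) := by
  obtain ⟨δ, hδ, hcoer⟩ := exists_coercive hA
  set M := ∑ i, ν i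
  set η : ι → ℝ := fun k => ∑ i, ∑ j, ‖(Q k - Q') i j‖
  set β : ι → ℝ := fun k => ∑ i, ‖(b k - b') i‖
  set γ : ι → ℝ := fun k => ∑ θ, ‖(c k - c') θ‖
  set B : ℝ := ∑ i, ‖b' i‖
  set C : ℝ := ∑ θ, ‖c' θ‖
  have hη : Tendsto η l (𝓝 0) := by
    have h0 : Continuous fun R : Matrix (Fin d) (Fin d) ℂ => ∑ i, ∑ j, ‖(R - Q') i j‖ := by
      simp only [Matrix.sub_apply]
      fun_prop
    simpa only [sub_self, Matrix.zero_apply, Pi.zero_apply, norm_zero, Finset.sum_const_zero]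
      using! (h0.tendsto Q').comp hQ
  have hβ : Tendsto β l (𝓝 0) := by
    have h0 : Continuous fun u : Fin d → ℂ => ∑ i, ‖(u - b') i‖ := by
      simp only [Pi.sub_apply]
      fun_prop
    simpa only [sub_self, Matrix.zero_apply, Pi.zero_apply, norm_zero, Finset.sum_const_zero]
      using! (h0.tendsto b').comp hb
  have hγ : Tendsto γ l (𝓝 0) := by
    have h0 : Continuous fun u : boxIndex ν → ℂ => ∑ θ, ‖(u - c') θ‖ := by
      simp only [Pi.sub_apply]
      fun_prop
    simpa only [sub_self, Matrix.zero_apply, Pi.zero_apply, norm_zero, Finset.sum_const_zero]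
      using! (h0.tendsto c').comp hc
  -- The power `M` bounds the polynomials, `2` the difference of the phases, and `d + 1` leaves an
  -- integrable weight. Coercivity gives decay `δ / 2`; eventually `η k < δ / 4` and `β k < 1`,
  -- which leaves the rate `δ / 4` and the linear term `B + 1`.
  obtain ⟨K, hK, hKle⟩ := exists_pow_mul_exp_le (M + 2 + (d + 1)) (a := δ / 4) (by positivity)
    (B + 1)
  have hσ : Tendsto (fun k => K * (γ k + C * (η k + β k))) l (𝓝 0) := by
    simpa using (hγ.add ((hη.add hβ).const_mul C)).const_mul K
  have hfin := eLpNorm_inv_one_add_norm_pow_ne_top d hs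
  have hlim : Tendsto (fun k => ENNReal.ofReal (K * (γ k + C * (η k + β k))) *
      eLpNorm (fun x : Space d => ((1 + ‖x‖) ^ (d + 1))⁻¹) s volume) l (𝓝 0) := by
    have := ENNReal.Tendsto.mul_const (b := eLpNorm (fun x : Space d => ((1 + ‖x‖) ^ (d + 1))⁻¹)
      s volume) (ENNReal.tendsto_ofReal hσ) (Or.inr hfin)
    simpa using this
  refine tendsto_of_tendsto_of_tendsto_of_le_of_le' tendsto_const_nhds hlim
    (Eventually.of_forall fun _ => zero_le) ?_
  have hη' : ∀ᶠ k in l, η k < δ / 4 := hη.eventually_lt_const (by positivity)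
  have hβ' : ∀ᶠ k in l, β k < 1 := hβ.eventually_lt_const one_pos
  filter_upwards [hη', hβ'] with k hk1 hk2
  refine eLpNorm_le_mul_eLpNorm_of_ae_le_mul (Eventually.of_forall fun x => ?_) s
  set t := ‖x‖
  have ht : 0 ≤ t := norm_nonneg x
  have hη0 : 0 ≤ η k := by positivity
  have hβ0 : 0 ≤ β k := by positivity
  have hγ0 : 0 ≤ γ k := by positivity
  have hC0 : 0 ≤ C := by positivity
  have hB0 : 0 ≤ B := by positivity
  have hdiff : ‖quadPhase (Q k) (b k) x - quadPhase Q' b' x‖ ≤ η k * t ^ 2 + β k * t := by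
    rw [quadPhase_sub]
    exact norm_quadPhase_le _ _ x
  have hre' : (quadPhase Q' b' x).re ≤ -(δ / 2) * t ^ 2 + B * t := by
    have h1 : (quadPhase Q' b' x).re = -(1 / 2) * dotProduct x.ofLp
        ((Q'.map Complex.re).mulVec x.ofLp) + (dotProduct b' (cvec x)).re := by
      rw [quadPhase, Complex.add_re, ← re_dotProduct_mulVec_cvec,
        show (-(1 / 2) : ℂ) = ((-(1 / 2) : ℝ) : ℂ) by push_cast; rfl, Complex.re_ofReal_mul]
    have h2 := hcoer x
    have h3 := (Complex.re_le_norm _).trans (norm_dotProduct_cvec_le b' x)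
    rw [h1]
    change _ ≤ B * t at h3
    change δ * t ^ 2 ≤ _ at h2
    linarith
  have hp1 : ‖MvPolynomial.eval (cvec x) (polyOfCoeff (c k - c'))‖ ≤ γ k * (1 + t) ^ M :=
    norm_eval_polyOfCoeff_le _ x
  have hp2 : ‖MvPolynomial.eval (cvec x) (polyOfCoeff c')‖ ≤ C * (1 + t) ^ M :=
    norm_eval_polyOfCoeff_le _ x
  clear_value η β γ B C M
  set m : ℝ := -(δ / 4) * t ^ 2 + (B + 1) * t
  have hm' : (quadPhase Q' b' x).re ≤ m := by
    have : 0 ≤ δ / 4 * t ^ 2 := by positivity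
    simp only [m]
    linarith
  have hm : (quadPhase (Q k) (b k) x).re ≤ m := by
    have h1 := (Complex.re_le_norm _).trans hdiff
    rw [Complex.sub_re] at h1
    have h2 : η k * t ^ 2 ≤ δ / 4 * t ^ 2 := by gcongr
    have h3 : β k * t ≤ 1 * t := by gcongr
    simp only [m]
    linarith
  have hdiff2 : η k * t ^ 2 + β k * t ≤ (η k + β k) * (1 + t) ^ 2 := by nlinarith
  have hexp := norm_cexp_sub_cexp_le hm hm'
  have hE : Real.exp m * (1 + t) ^ (M + 2) ≤ K * ((1 + t) ^ (d + 1))⁻¹ := by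
    rw [← div_eq_mul_inv, le_div_iff₀ (by positivity), mul_assoc, ← pow_add, mul_comm]
    exact hKle t ht
  -- Change the polynomial first, then the exponential.
  have key : polyExp (polyOfCoeff (c k)) (Q k) (b k) x - polyExp (polyOfCoeff c') Q' b' x =
      MvPolynomial.eval (cvec x) (polyOfCoeff (c k - c')) * Complex.exp (quadPhase (Q k) (b k) x) +
      MvPolynomial.eval (cvec x) (polyOfCoeff c') *
        (Complex.exp (quadPhase (Q k) (b k) x) - Complex.exp (quadPhase Q' b' x)) := by
    rw [← polyOfCoeff_sub, map_sub]
    simp only [polyExp]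
    ring
  rw [key, Real.norm_of_nonneg (inv_nonneg.2 (by positivity : (0 : ℝ) ≤ (1 + t) ^ (d + 1)))]
  calc _ ≤ (γ k * (1 + t) ^ M) * Real.exp m +
        (C * (1 + t) ^ M) * (Real.exp m * ((η k + β k) * (1 + t) ^ 2)) := by
        refine (norm_add_le _ _).trans (add_le_add ?_ ?_)
        · rw [norm_mul, Complex.norm_exp]
          exact mul_le_mul hp1 (Real.exp_le_exp.2 hm) (Real.exp_pos _).le (by positivity)
        · rw [norm_mul]
          exact mul_le_mul hp2 (hexp.trans (mul_le_mul_of_nonneg_left (hdiff.trans hdiff2)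
            (Real.exp_pos _).le)) (norm_nonneg _) (by positivity)
    _ ≤ (γ k * (1 + t) ^ (M + 2)) * Real.exp m +
        (C * (1 + t) ^ M) * (Real.exp m * ((η k + β k) * (1 + t) ^ 2)) := by
        gcongr
        · linarith
        · omega
    _ = (γ k + C * (η k + β k)) * (Real.exp m * (1 + t) ^ (M + 2)) := by ring
    _ ≤ (γ k + C * (η k + β k)) * (K * ((1 + t) ^ (d + 1))⁻¹) := by gcongr
    _ = _ := by ring

/-! ### Centred and expanded forms of a wave packet -/

theorem cmat_map_re {d : ℕ} (A B : Matrix (Fin d) (Fin d) ℝ) : (cmat A B).map Complex.re = A := by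
  ext i j; simp [cmat]

theorem cmat_re_im {d : ℕ} (Q : Matrix (Fin d) (Fin d) ℂ) :
    cmat (Q.map Complex.re) (Q.map Complex.im) = Q := by
  ext i j
  simp [cmat, mul_comm Complex.I, Complex.re_add_im]

theorem isSymm_cmat {d : ℕ} {A B : Matrix (Fin d) (Fin d) ℝ} (hA : A.IsSymm) (hB : B.IsSymm) :
    (cmat A B).IsSymm := by
  ext i j
  simp [cmat, hA.apply i j, hB.apply i j]

theorem isSymm_of_posDef {d : ℕ} {A : Matrix (Fin d) (Fin d) ℝ} (hA : A.PosDef) : A.IsSymm := by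
  simpa [Matrix.IsHermitian, Matrix.IsSymm, Matrix.conjTranspose_eq_transpose_of_trivial]
    using hA.isHermitian

/-- The constant relating the centred and the expanded forms of a wave packet. -/
noncomputable def expandConst {d : ℕ} (Q : Matrix (Fin d) (Fin d) ℂ) (p q : Space d) : ℂ :=
  Complex.exp (-(1 / 2 : ℂ) * dotProduct (cvec q) (Q.mulVec (cvec q)) -
    Complex.I * dotProduct (cvec p) (cvec q))

/-- By symmetry of `Q` the two cross terms of the square coincide and contribute `Q q` to the linear
part. -/
theorem wavePacket_eq_polyExp {d : ℕ} {Q : Matrix (Fin d) (Fin d) ℂ} (hQ : Q.IsSymm)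
    (P : MvPolynomial (Fin d) ℂ) (p q : Space d) :
    wavePacket P p q Q = polyExp (MvPolynomial.C (expandConst Q p q) * P) Q
      (Q.mulVec (cvec q) + Complex.I • cvec p) := by
  ext x
  have hs : cvec (x - q) = cvec x - cvec q := by ext i; simp [cvec]
  have h : dotProduct (cvec x) (Q.mulVec (cvec q)) = dotProduct (cvec q) (Q.mulVec (cvec x)) := by
    rw [Matrix.dotProduct_mulVec, ← Matrix.mulVec_transpose, hQ.eq, dotProduct_comm]
  have h' : dotProduct (Q.mulVec (cvec q)) (cvec x) = dotProduct (cvec q) (Q.mulVec (cvec x)) := by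
    rw [dotProduct_comm, h]
  have e : gaussianPhase p q Q x = expandConst Q p q *
      Complex.exp (quadPhase Q (Q.mulVec (cvec q) + Complex.I • cvec p) x) := by
    rw [gaussianPhase, expandConst, ← Complex.exp_add, ← Complex.exp_add]
    congr 1
    simp only [quadPhase, hs, Matrix.mulVec_sub, dotProduct_sub, sub_dotProduct, add_dotProduct,
      smul_dotProduct, smul_eq_mul, h, h']
    ring
  rw [polyExp_C_mul, wavePacket, polyExp, e, mul_left_comm]

/-- The centre `q = A⁻¹ Re b` of the wave packet with phase `-½ x · Q x + b · x`. -/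
noncomputable def centre {d : ℕ} (Q : Matrix (Fin d) (Fin d) ℂ) (b : Fin d → ℂ) : Space d :=
  WithLp.toLp 2 ((Q.map Complex.re)⁻¹.mulVec fun i => (b i).re)

/-- The momentum `p = Im b - B q` of the wave packet with phase `-½ x · Q x + b · x`. -/
noncomputable def momentum {d : ℕ} (Q : Matrix (Fin d) (Fin d) ℂ) (b : Fin d → ℂ) : Space d :=
  WithLp.toLp 2 ((fun i => (b i).im) - (Q.map Complex.im).mulVec (centre Q b).ofLp)

theorem mulVec_cvec_re {d : ℕ} (Q : Matrix (Fin d) (Fin d) ℂ) (x : Space d) (i : Fin d) :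
    (Q.mulVec (cvec x) i).re = (Q.map Complex.re).mulVec x.ofLp i := by
  simp [Matrix.mulVec, dotProduct, cvec]

theorem mulVec_cvec_im {d : ℕ} (Q : Matrix (Fin d) (Fin d) ℂ) (x : Space d) (i : Fin d) :
    (Q.mulVec (cvec x) i).im = (Q.map Complex.im).mulVec x.ofLp i := by
  simp [Matrix.mulVec, dotProduct, cvec]

/-- Real and imaginary parts of `Q q + i p = b` read `A q = Re b` and `B q + p = Im b`, solvable
because `A` is invertible. -/
theorem mulVec_centre_add_momentum {d : ℕ} {Q : Matrix (Fin d) (Fin d) ℂ}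
    (hA : (Q.map Complex.re).PosDef) (b : Fin d → ℂ) :
    Q.mulVec (cvec (centre Q b)) + Complex.I • cvec (momentum Q b) = b := by
  have hdet : IsUnit (Q.map Complex.re).det := hA.det_pos.ne'.isUnit
  ext i
  apply Complex.ext
  · simp only [Pi.add_apply, Complex.add_re, mulVec_cvec_re]
    simp [centre, Matrix.mulVec_mulVec, Matrix.mul_nonsing_inv _ hdet, cvec]
  · simp only [Pi.add_apply, Complex.add_im, mulVec_cvec_im]
    simp [momentum, cvec]

theorem centre_mulVec_add {d : ℕ} {Q : Matrix (Fin d) (Fin d) ℂ}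
    (hA : (Q.map Complex.re).PosDef) (p q : Space d) :
    centre Q (Q.mulVec (cvec q) + Complex.I • cvec p) = q := by
  have hdet : IsUnit (Q.map Complex.re).det := hA.det_pos.ne'.isUnit
  have : (fun i => ((Q.mulVec (cvec q) + Complex.I • cvec p) i).re) =
      (Q.map Complex.re).mulVec q.ofLp := by
    ext i
    simp only [Pi.add_apply, Complex.add_re, mulVec_cvec_re]
    simp [cvec]
  rw [centre, this, Matrix.mulVec_mulVec, Matrix.nonsing_inv_mul _ hdet, Matrix.one_mulVec]

theorem momentum_mulVec_add {d : ℕ} {Q : Matrix (Fin d) (Fin d) ℂ}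
    (hA : (Q.map Complex.re).PosDef) (p q : Space d) :
    momentum Q (Q.mulVec (cvec q) + Complex.I • cvec p) = p := by
  have : (fun i => ((Q.mulVec (cvec q) + Complex.I • cvec p) i).im) =
      (Q.map Complex.im).mulVec q.ofLp + p.ofLp := by
    ext i
    simp only [Pi.add_apply, Complex.add_im, mulVec_cvec_im]
    simp [cvec]
  rw [momentum, this, centre_mulVec_add hA, add_sub_cancel_left]

theorem tendsto_centre {d : ℕ} {ι : Type*} {l : Filter ι} {Q : ι → Matrix (Fin d) (Fin d) ℂ}
    {b : ι → Fin d → ℂ} {Q' : Matrix (Fin d) (Fin d) ℂ} {b' : Fin d → ℂ}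
    (hQ : Tendsto Q l (𝓝 Q')) (hb : Tendsto b l (𝓝 b')) (hA : (Q'.map Complex.re).PosDef) :
    Tendsto (fun k => centre (Q k) (b k)) l (𝓝 (centre Q' b')) := by
  have h1 : Tendsto (fun k => (Q k).map Complex.re) l (𝓝 (Q'.map Complex.re)) :=
    ((continuous_id.matrix_map Complex.continuous_re).tendsto Q').comp hQ
  have hinv : ContinuousAt Inv.inv (Q'.map Complex.re) := by
    refine continuousAt_matrix_inv _ ?_
    rw [Ring.inverse_eq_inv']
    exact continuousAt_inv₀ hA.det_pos.ne'
  have h2 : Tendsto (fun k => ((Q k).map Complex.re)⁻¹) l (𝓝 (Q'.map Complex.re)⁻¹) :=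
    hinv.tendsto.comp h1
  have h3 : Tendsto (fun k => fun i => (b k i).re) l (𝓝 fun i => (b' i).re) := by
    have : Continuous fun (u : Fin d → ℂ) (i : Fin d) => (u i).re := by fun_prop
    exact (this.tendsto b').comp hb
  have h4 : Continuous fun z : Matrix (Fin d) (Fin d) ℝ × (Fin d → ℝ) =>
      (WithLp.toLp 2 (z.1.mulVec z.2) : Space d) := by fun_prop
  have h5 := Tendsto.comp (h4.tendsto ((Q'.map Complex.re)⁻¹, fun i => (b' i).re))
    (h2.prodMk_nhds h3)
  simp only [Function.comp_def] at h5
  exact h5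

theorem tendsto_momentum {d : ℕ} {ι : Type*} {l : Filter ι} {Q : ι → Matrix (Fin d) (Fin d) ℂ}
    {b : ι → Fin d → ℂ} {Q' : Matrix (Fin d) (Fin d) ℂ} {b' : Fin d → ℂ}
    (hQ : Tendsto Q l (𝓝 Q')) (hb : Tendsto b l (𝓝 b')) (hA : (Q'.map Complex.re).PosDef) :
    Tendsto (fun k => momentum (Q k) (b k)) l (𝓝 (momentum Q' b')) := by
  have h1 : Tendsto (fun k => (Q k).map Complex.im) l (𝓝 (Q'.map Complex.im)) :=
    ((continuous_id.matrix_map Complex.continuous_im).tendsto Q').comp hQ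
  have h3 : Tendsto (fun k => fun i => (b k i).im) l (𝓝 fun i => (b' i).im) := by
    have : Continuous fun (u : Fin d → ℂ) (i : Fin d) => (u i).im := by fun_prop
    exact (this.tendsto b').comp hb
  have h4 : Continuous fun z : Matrix (Fin d) (Fin d) ℝ × (Fin d → ℝ) × Space d =>
      (WithLp.toLp 2 (z.2.1 - z.1.mulVec z.2.2.ofLp) : Space d) := by fun_prop
  have h5 := Tendsto.comp (h4.tendsto (Q'.map Complex.im, (fun i => (b' i).im), centre Q' b'))
    (h1.prodMk_nhds (h3.prodMk_nhds (tendsto_centre hQ hb hA)))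
  simp only [Function.comp_def] at h5
  exact h5

theorem tendsto_expandConst {d : ℕ} {ι : Type*} {l : Filter ι} {Q : ι → Matrix (Fin d) (Fin d) ℂ}
    {p q : ι → Space d} {Q' : Matrix (Fin d) (Fin d) ℂ} {p' q' : Space d}
    (hQ : Tendsto Q l (𝓝 Q')) (hp : Tendsto p l (𝓝 p')) (hq : Tendsto q l (𝓝 q')) :
    Tendsto (fun k => expandConst (Q k) (p k) (q k)) l (𝓝 (expandConst Q' p' q')) := by
  have h : Continuous fun z : Matrix (Fin d) (Fin d) ℂ × Space d × Space d =>
      expandConst z.1 z.2.1 z.2.2 := by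
    have := continuous_cvec (d := d)
    unfold expandConst
    fun_prop
  have h5 := Tendsto.comp (h.tendsto (Q', p', q')) (hQ.prodMk_nhds (hp.prodMk_nhds hq))
  simp only [Function.comp_def] at h5
  exact h5

theorem C_mul_mem_boxPolynomials {d : ℕ} {ν : Fin d → ℕ} {P : MvPolynomial (Fin d) ℂ}
    (hP : P ∈ boxPolynomials ν) (a : ℂ) : MvPolynomial.C a * P ∈ boxPolynomials ν := fun j =>
  (MvPolynomial.degreeOf_C_mul_le P j a).trans (hP j)

theorem expandConst_ne_zero {d : ℕ} (Q : Matrix (Fin d) (Fin d) ℂ) (p q : Space d) :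
    expandConst Q p q ≠ 0 := Complex.exp_ne_zero _

theorem polyExp_eq_wavePacket {d : ℕ} {Q : Matrix (Fin d) (Fin d) ℂ} (hQ : Q.IsSymm)
    (hA : (Q.map Complex.re).PosDef) (P : MvPolynomial (Fin d) ℂ) (b : Fin d → ℂ) :
    polyExp P Q b = wavePacket (MvPolynomial.C (expandConst Q (momentum Q b) (centre Q b))⁻¹ * P)
      (momentum Q b) (centre Q b) Q := by
  rw [wavePacket_eq_polyExp hQ, mulVec_centre_add_momentum hA, ← mul_assoc, ← MvPolynomial.C_mul,
    mul_inv_cancel₀ (expandConst_ne_zero _ _ _), MvPolynomial.C_1, one_mul]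

theorem wavePacket_mem_polyGaussians {d : ℕ} {ν : Fin d → ℕ} {P : MvPolynomial (Fin d) ℂ}
    (hP : P ∈ boxPolynomials ν) (p q : Space d) {A B : Matrix (Fin d) (Fin d) ℝ} (hA : A.PosDef)
    (hB : B.IsSymm) : wavePacket P p q (cmat A B) ∈ polyGaussians ν :=
  ⟨P, hP, gaussianPhase p q (cmat A B), ⟨1, p, q, A, B, hA, hB, by simp⟩, rfl⟩

theorem polyExp_mem_polyGaussians {d : ℕ} {ν : Fin d → ℕ} {P : MvPolynomial (Fin d) ℂ}
    (hP : P ∈ boxPolynomials ν) {Q : Matrix (Fin d) (Fin d) ℂ} (hQ : Q.IsSymm)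
    (hA : (Q.map Complex.re).PosDef) (b : Fin d → ℂ) : polyExp P Q b ∈ polyGaussians ν := by
  rw [polyExp_eq_wavePacket hQ hA]
  have h := wavePacket_mem_polyGaussians (C_mul_mem_boxPolynomials hP
    (expandConst Q (momentum Q b) (centre Q b))⁻¹) (momentum Q b) (centre Q b) hA
    (hQ.map Complex.im)
  rwa [cmat_re_im] at h

theorem exists_polyExp_of_mem_polyGaussians {d : ℕ} {ν : Fin d → ℕ} {h : Space d → ℂ}
    (hh : h ∈ polyGaussians ν) : ∃ P ∈ boxPolynomials ν, ∃ (Q : Matrix (Fin d) (Fin d) ℂ)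
      (b : Fin d → ℂ), Q.IsSymm ∧ (Q.map Complex.re).PosSemidef ∧ h = polyExp P Q b := by
  obtain ⟨P, hP, g, ⟨a, p, q, A, B, hA, hB, rfl⟩, rfl⟩ := hh
  have hQ := isSymm_cmat (isSymm_of_posDef hA) hB
  refine ⟨MvPolynomial.C (expandConst (cmat A B) p q) * (MvPolynomial.C a * P),
    C_mul_mem_boxPolynomials (C_mul_mem_boxPolynomials hP _) _, cmat A B, _, hQ, ?_,
    Eq.trans ?_ (wavePacket_eq_polyExp hQ _ p q)⟩
  · rw [cmat_map_re]
    exact hA.posSemidef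
  · ext x
    simp [wavePacket]
    ring

/-! ### Limits of parameters and of wave packets -/

theorem isSymm_of_tendsto {d : ℕ} {ι : Type*} {l : Filter ι} [NeBot l]
    {Q : ι → Matrix (Fin d) (Fin d) ℂ} {Q' : Matrix (Fin d) (Fin d) ℂ}
    (hQ : Tendsto Q l (𝓝 Q')) (h : ∀ k, (Q k).IsSymm) : Q'.IsSymm := by
  have h1 : Tendsto (fun k => (Q k).transpose) l (𝓝 Q'.transpose) :=
    (continuous_id.matrix_transpose.tendsto Q').comp hQ
  simp only [fun k => (h k).eq] at h1
  exact tendsto_nhds_unique h1 hQ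

theorem posSemidef_of_tendsto {d : ℕ} {ι : Type*} {l : Filter ι} [NeBot l]
    {Q : ι → Matrix (Fin d) (Fin d) ℂ} {Q' : Matrix (Fin d) (Fin d) ℂ}
    (hQ : Tendsto Q l (𝓝 Q')) (hs : Q'.IsSymm) (h : ∀ k, ((Q k).map Complex.re).PosSemidef) :
    (Q'.map Complex.re).PosSemidef := by
  have h1 : Tendsto (fun k => (Q k).map Complex.re) l (𝓝 (Q'.map Complex.re)) :=
    ((continuous_id.matrix_map Complex.continuous_re).tendsto Q').comp hQ
  refine Matrix.PosSemidef.of_dotProduct_mulVec_nonneg ?_ fun x => ?_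
  · rw [Matrix.IsHermitian, Matrix.conjTranspose_eq_transpose_of_trivial]
    exact hs.map Complex.re
  · have hc : Continuous fun A : Matrix (Fin d) (Fin d) ℝ => dotProduct (star x) (A.mulVec x) := by
      fun_prop
    exact ge_of_tendsto' ((hc.tendsto _).comp h1) fun k => (h k).dotProduct_mulVec_nonneg x

/-- Nonzero distributional limits of functions `P_k exp (-½ x · Q_k x + b_k · x)` with
`Re Q_k ≥ 0` along an ultrafilter are of the same form, with convergence of the parameters. -/
theorem exists_polyExp_of_tendsto_ultrafilter {d : ℕ} {ι : Type*} (U : Ultrafilter ι)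
    {ν : Fin d → ℕ} {P : ι → MvPolynomial (Fin d) ℂ} {Q : ι → Matrix (Fin d) (Fin d) ℂ}
    {b : ι → Fin d → ℂ} (hP : ∀ k, P k ∈ boxPolynomials ν) (hQ : ∀ k, (Q k).IsSymm)
    (hA : ∀ k, ((Q k).map Complex.re).PosSemidef) {f : Space d → ℂ}
    (hf : LocallyIntegrable f volume)
    (hlim : ∀ φ : testFunctions d, Tendsto (fun k => ∫ x, polyExp (P k) (Q k) (b k) x * φ.1 x) U
      (𝓝 (∫ x, f x * φ.1 x))) (hf0 : ¬ f =ᵐ[volume] 0) :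
    ∃ P' ∈ boxPolynomials ν, ∃ (Q' : Matrix (Fin d) (Fin d) ℂ) (b' : Fin d → ℂ),
      (∀ θ, Tendsto (fun k => (P k).coeff θ) U (𝓝 (P'.coeff θ))) ∧ Tendsto Q U (𝓝 Q') ∧
      Tendsto b U (𝓝 b') ∧ Q'.IsSymm ∧ (Q'.map Complex.re).PosSemidef ∧ P' ≠ 0 ∧
      f =ᵐ[volume] polyExp P' Q' b' := by
  obtain ⟨Q', b', hQ', hb'⟩ := exists_tendsto_phase U hP hQ hf hlim hf0
  obtain ⟨P', hP', hc, hae⟩ := exists_tendsto_coeff U hP hQ' hb' hf hlim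
  have hs := isSymm_of_tendsto hQ' hQ
  refine ⟨P', hP', Q', b', hc, hQ', hb', hs, posSemidef_of_tendsto hQ' hs hA, ?_, hae⟩
  rintro rfl
  refine hf0 (hae.trans (Eventually.of_forall fun x => ?_))
  simp [polyExp]

/-- The version of `exists_polyExp_of_tendsto_ultrafilter` for arbitrary filters. -/
theorem exists_polyExp_of_tendsto {d : ℕ} {ι : Type*} (l : Filter ι) [NeBot l]
    {ν : Fin d → ℕ} {P : ι → MvPolynomial (Fin d) ℂ} {Q : ι → Matrix (Fin d) (Fin d) ℂ}
    {b : ι → Fin d → ℂ} (hP : ∀ k, P k ∈ boxPolynomials ν) (hQ : ∀ k, (Q k).IsSymm)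
    (hA : ∀ k, ((Q k).map Complex.re).PosSemidef) {f : Space d → ℂ}
    (hf : LocallyIntegrable f volume)
    (hlim : ∀ φ : testFunctions d, Tendsto (fun k => ∫ x, polyExp (P k) (Q k) (b k) x * φ.1 x) l
      (𝓝 (∫ x, f x * φ.1 x))) (hf0 : ¬ f =ᵐ[volume] 0) :
    ∃ P' ∈ boxPolynomials ν, ∃ (Q' : Matrix (Fin d) (Fin d) ℂ) (b' : Fin d → ℂ),
      (∀ θ, Tendsto (fun k => (P k).coeff θ) l (𝓝 (P'.coeff θ))) ∧ Tendsto Q l (𝓝 Q') ∧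
      Tendsto b l (𝓝 b') ∧ Q'.IsSymm ∧ (Q'.map Complex.re).PosSemidef ∧ P' ≠ 0 ∧
      f =ᵐ[volume] polyExp P' Q' b' := by
  obtain ⟨P', hP', Q', b', -, -, -, hs, hpsd, hne, hae⟩ :=
    exists_polyExp_of_tendsto_ultrafilter (Ultrafilter.of l) hP hQ hA hf
      (fun φ => (hlim φ).mono_left (Ultrafilter.of_le l)) hf0
  have key : ∀ U : Ultrafilter ι, ↑U ≤ l →
      (∀ θ, Tendsto (fun k => (P k).coeff θ) U (𝓝 (P'.coeff θ))) ∧ Tendsto Q U (𝓝 Q') ∧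
        Tendsto b U (𝓝 b') := by
    intro U hU
    obtain ⟨P₁, -, Q₁, b₁, h1, h2, h3, hs₁, -, -, hae₁⟩ :=
      exists_polyExp_of_tendsto_ultrafilter U hP hQ hA hf (fun φ => (hlim φ).mono_left hU) hf0
    -- Both representatives of `f` are continuous, so they agree everywhere and the limits do not
    -- depend on the ultrafilter.
    obtain ⟨rfl, rfl, rfl⟩ := polyExp_injective hs hs₁ hne
      ((Continuous.ae_eq_iff_eq volume (continuous_polyExp _ _ _) (continuous_polyExp _ _ _)).1
        (hae.symm.trans hae₁))
    exact ⟨h1, h2, h3⟩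
  exact ⟨P', hP', Q', b', fun θ => tendsto_iff_ultrafilter _ _ _ |>.2 fun U hU => (key U hU).1 θ,
    tendsto_iff_ultrafilter _ _ _ |>.2 fun U hU => (key U hU).2.1,
    tendsto_iff_ultrafilter _ _ _ |>.2 fun U hU => (key U hU).2.2, hs, hpsd, hne, hae⟩

/-- Fatou's lemma: convergence of the parameters gives pointwise convergence of the functions. -/
theorem eLpNorm_polyExp_lt_top_of_tendsto {d : ℕ} {ν : Fin d → ℕ} {c : ℕ → boxIndex ν → ℂ}
    {Q : ℕ → Matrix (Fin d) (Fin d) ℂ} {b : ℕ → Fin d → ℂ} {c' : boxIndex ν → ℂ}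
    {Q' : Matrix (Fin d) (Fin d) ℂ} {b' : Fin d → ℂ} (hc : Tendsto c atTop (𝓝 c'))
    (hQ : Tendsto Q atTop (𝓝 Q')) (hb : Tendsto b atTop (𝓝 b')) {r : ℝ≥0∞}
    (h : (⨆ k, eLpNorm (polyExp (polyOfCoeff (c k)) (Q k) (b k)) r volume) < ⊤) :
    eLpNorm (polyExp (polyOfCoeff c') Q' b') r volume < ⊤ := by
  refine lt_of_le_of_lt ((Lp.eLpNorm_lim_le_liminf_eLpNorm
    (fun k => (continuous_polyExp (polyOfCoeff (c k)) (Q k) (b k)).aestronglyMeasurable) _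
    (Eventually.of_forall fun x => ?_)).trans ?_) h
  · have hz : Tendsto (fun k => ((c k, Q k, b k), x)) atTop (𝓝 ((c', Q', b'), x)) :=
      (hc.prodMk_nhds (hQ.prodMk_nhds hb)).prodMk_nhds tendsto_const_nhds
    have h1 := Tendsto.comp ((continuous_polyExp_param ν).tendsto ((c', Q', b'), x)) hz
    simp only [Function.comp_def] at h1
    exact h1
  · exact (liminf_le_limsup).trans (limsup_le_iSup)

/-- Sequential form: a bounded sequence of wave packets converging in the sense of distributions
to a nonzero function converges strongly, together with its parameters. -/
theorem wavePacket_limit {d : ℕ} {ν : Fin d → ℕ} {r : ℝ≥0∞} (hr0 : r ≠ 0) (hr : r ≠ ⊤)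
    {P : ℕ → MvPolynomial (Fin d) ℂ} {p q : ℕ → Space d} {A B : ℕ → Matrix (Fin d) (Fin d) ℝ}
    {g : Space d → ℂ} (hP : ∀ k, P k ∈ boxPolynomials ν) (hA : ∀ k, (A k).PosDef)
    (hB : ∀ k, (B k).IsSymm)
    (hbdd : (⨆ k, eLpNorm (wavePacket (P k) (p k) (q k) (cmat (A k) (B k))) r volume) < ⊤)
    (hg : LocallyIntegrable g volume)
    (hlim : TendstoDistribution (fun k => wavePacket (P k) (p k) (q k) (cmat (A k) (B k))) g)
    (hg0 : ¬ g =ᵐ[volume] 0) :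
    ∃ (P' : MvPolynomial (Fin d) ℂ) (p' q' : Space d) (A' B' : Matrix (Fin d) (Fin d) ℝ),
      P' ∈ boxPolynomials ν ∧ A'.PosDef ∧ B'.IsSymm ∧
      g =ᵐ[volume] wavePacket P' p' q' (cmat A' B') ∧
      wavePacket P' p' q' (cmat A' B') ∈ polyGaussians ν \ {0} ∧
      (∀ θ : Fin d →₀ ℕ, Tendsto (fun k => (P k).coeff θ) atTop (𝓝 (P'.coeff θ))) ∧
      Tendsto p atTop (𝓝 p') ∧ Tendsto q atTop (𝓝 q') ∧
      Tendsto (fun k => cmat (A k) (B k)) atTop (𝓝 (cmat A' B')) ∧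
      ∀ s : ℝ≥0∞, 1 ≤ s → Tendsto (fun k => eLpNorm (fun x =>
        wavePacket (P k) (p k) (q k) (cmat (A k) (B k)) x - g x) s volume) atTop (𝓝 0) := by
  set Q : ℕ → Matrix (Fin d) (Fin d) ℂ := fun k => cmat (A k) (B k) with hQdef
  have hQ : ∀ k, (Q k).IsSymm := fun k => isSymm_cmat (isSymm_of_posDef (hA k)) (hB k)
  have hQA : ∀ k, ((Q k).map Complex.re).PosDef := fun k => by
    rw [hQdef, cmat_map_re]; exact hA k
  set b : ℕ → Fin d → ℂ := fun k => (Q k).mulVec (cvec (q k)) + Complex.I • cvec (p k) with hbdef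
  set R : ℕ → MvPolynomial (Fin d) ℂ := fun k =>
    MvPolynomial.C (expandConst (Q k) (p k) (q k)) * P k with hRdef
  have hR : ∀ k, R k ∈ boxPolynomials ν := fun k => C_mul_mem_boxPolynomials (hP k) _
  have hw : ∀ k, wavePacket (P k) (p k) (q k) (Q k) = polyExp (R k) (Q k) (b k) := fun k =>
    wavePacket_eq_polyExp (hQ k) _ _ _
  have hlim' : ∀ φ : testFunctions d, Tendsto (fun k => ∫ x, polyExp (R k) (Q k) (b k) x * φ.1 x)
      atTop (𝓝 (∫ x, g x * φ.1 x)) := fun φ => by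
    simp_rw [← hw]
    exact hlim φ.1 φ.2.1 φ.2.2
  obtain ⟨R', hR', Q', b', hRlim, hQlim, hblim, hs, hpsd, hne, hae⟩ :=
    exists_polyExp_of_tendsto atTop hR hQ (fun k => (hQA k).posSemidef) hg hlim' hg0
  have hclim : Tendsto (fun k => fun θ : boxIndex ν => (R k).coeff θ.1) atTop
      (𝓝 fun θ : boxIndex ν => R'.coeff θ.1) := tendsto_pi_nhds.2 fun θ => hRlim θ.1
  have hfin : eLpNorm (polyExp R' Q' b') r volume < ⊤ := by
    have := eLpNorm_polyExp_lt_top_of_tendsto (r := r) hclim hQlim hblim (by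
      simpa only [polyOfCoeff_coeff (hR _), ← hw] using hbdd)
    rwa [polyOfCoeff_coeff hR'] at this
  have hpd := posDef_of_eLpNorm_lt_top hs hpsd hne hr0 hr hfin
  have hqlim : Tendsto q atTop (𝓝 (centre Q' b')) :=
    (tendsto_centre hQlim hblim hpd).congr fun k => centre_mulVec_add (hQA k) _ _
  have hplim : Tendsto p atTop (𝓝 (momentum Q' b')) :=
    (tendsto_momentum hQlim hblim hpd).congr fun k => momentum_mulVec_add (hQA k) _ _
  have hκ := tendsto_expandConst hQlim hplim hqlim
  have hP' := C_mul_mem_boxPolynomials hR' (expandConst Q' (momentum Q' b') (centre Q' b'))⁻¹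
  have hae' := hae
  rw [polyExp_eq_wavePacket hs hpd] at hae'
  have hmem := wavePacket_mem_polyGaussians hP' (momentum Q' b') (centre Q' b') hpd
    (hs.map Complex.im)
  rw [cmat_re_im] at hmem
  refine ⟨MvPolynomial.C (expandConst Q' (momentum Q' b') (centre Q' b'))⁻¹ * R',
    momentum Q' b', centre Q' b', Q'.map Complex.re, Q'.map Complex.im, hP', hpd,
    hs.map Complex.im, ?_⟩
  rw [cmat_re_im]
  refine ⟨hae', ⟨hmem, ?_⟩, fun θ => ?_, hplim, hqlim, hQlim, fun s h1 => ?_⟩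
  · intro h0
    exact hg0 (hae'.trans (Eventually.of_forall (congrFun h0)))
  · rw [MvPolynomial.coeff_C_mul]
    -- The original coefficients are those of `R k` divided by the expansion constant, whose limit
    -- is nonzero.
    refine ((hκ.inv₀ (expandConst_ne_zero _ _ _)).mul (hRlim θ)).congr fun k => ?_
    simp only [hRdef, MvPolynomial.coeff_C_mul]
    exact inv_mul_cancel_left₀ (expandConst_ne_zero _ _ _) _
  · refine (tendsto_eLpNorm_polyExp hclim hQlim hblim hpd h1).congr fun k => ?_
    refine eLpNorm_congr_ae ?_
    filter_upwards [hae] with x hx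
    rw [polyOfCoeff_coeff (hR k), polyOfCoeff_coeff hR', hx, hw]

/-! ### Weak closedness -/

/-- A test function lies in the conjugate Lebesgue space, so by Hölder the pairing is a continuous
linear functional on `L^r`, hence weakly continuous. -/
theorem continuous_weakSpace_integral_mul {d : ℕ} {r : ℝ≥0∞} [Fact (1 ≤ r)]
    (φ : testFunctions d) :
    Continuous fun y : WeakSpace ℂ (Lp ℂ r (volume : Measure (Space d))) =>
      ∫ x, ((toWeakSpace ℂ (Lp ℂ r (volume : Measure (Space d)))).symm y) x * φ.1 x := by
  have hr := ENNReal.HolderConjugate.conjExponent (Fact.out : 1 ≤ r)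
  have : Fact (1 ≤ r.conjExponent) := ⟨hr.symm.one_le⟩
  have hφ : MemLp φ.1 r.conjExponent volume := φ.2.1.continuous.memLp_of_hasCompactSupport φ.2.2
  let T : Lp ℂ r (volume : Measure (Space d)) →L[ℂ] ℂ :=
    ((ContinuousLinearMap.mul ℂ ℂ).lpPairing volume r r.conjExponent).flip (hφ.toLp φ.1)
  have hT : ∀ y : Lp ℂ r (volume : Measure (Space d)), T y = ∫ x, y x * φ.1 x := by
    intro y
    simp only [T, ContinuousLinearMap.flip_apply, ContinuousLinearMap.lpPairing_eq_integral,
      ContinuousLinearMap.mul_apply']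
    refine integral_congr_ae ?_
    filter_upwards [hφ.coeFn_toLp] with x hx
    rw [hx]
  simp_rw [← hT]
  exact WeakBilin.eval_continuous _ T

/-- Ultrafilters replace sequences, so closedness is proved for the weak topology itself. No norm
bound along the ultrafilter is needed: the limit is an element of `L^r` from the start. -/
theorem isClosed_polyGaussiansLp {d : ℕ} (ν : Fin d → ℕ) (r : ℝ≥0∞) [hr1 : Fact (1 ≤ r)]
    (hr : r ≠ ⊤) : IsClosed (toWeakSpace ℂ (Lp ℂ r (volume : Measure (Space d))) ''
      polyGaussiansLp ν r) := by
  set S := toWeakSpace ℂ (Lp ℂ r (volume : Measure (Space d))) '' polyGaussiansLp ν r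
  set e := (toWeakSpace ℂ (Lp ℂ r (volume : Measure (Space d)))).symm
  have hr0 : r ≠ 0 := (zero_lt_one.trans_le hr1.out).ne'
  have hparam : ∀ y : WeakSpace ℂ (Lp ℂ r (volume : Measure (Space d))),
      ∃ (P : MvPolynomial (Fin d) ℂ) (Q : Matrix (Fin d) (Fin d) ℂ) (b : Fin d → ℂ),
        P ∈ boxPolynomials ν ∧ Q.IsSymm ∧ (Q.map Complex.re).PosSemidef ∧
        (y ∈ S → ⇑(e y) =ᵐ[volume] polyExp P Q b) := by
    intro y
    by_cases hy : y ∈ S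
    · obtain ⟨f, ⟨h, hh, hf⟩, rfl⟩ := hy
      obtain ⟨P, hP, Q, b, hQ, hA, rfl⟩ := exists_polyExp_of_mem_polyGaussians hh
      exact ⟨P, Q, b, hP, hQ, hA, fun _ => by simpa [e] using hf⟩
    -- Points outside `S` receive dummy parameters so that the families are defined on the whole
    -- space. The choice `Q = 0` is admissible because only semidefiniteness is required.
    · refine ⟨0, 0, 0, fun j => by simp, Matrix.isSymm_zero, ?_, fun h => absurd h hy⟩
      simpa using Matrix.PosSemidef.zero
  choose P Q b hP hQ hA hae using hparam
  refine isClosed_iff_ultrafilter.2 fun y U hU hS => ?_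
  have hLp : MemLp (e y) r volume := Lp.memLp _
  suffices h : ∃ h ∈ polyGaussians ν, ⇑(e y) =ᵐ[volume] h from ⟨e y, h, by simp [e]⟩
  by_cases hy0 : ⇑(e y) =ᵐ[volume] 0
  · have hone : ((1 : Matrix (Fin d) (Fin d) ℂ).map Complex.re).PosDef := by
      rw [Matrix.map_one _ (by simp) (by simp)]
      exact Matrix.PosDef.one
    -- The zero class belongs to the set, with zero polynomial and any admissible matrix.
    refine ⟨polyExp 0 1 0, polyExp_mem_polyGaussians (fun j => by simp) Matrix.isSymm_one hone 0,
      hy0.trans (Eventually.of_forall fun x => ?_)⟩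
    simp [polyExp]
  have hlim : ∀ φ : testFunctions d, Tendsto
      (fun z => ∫ x, polyExp (P z) (Q z) (b z) x * φ.1 x) U (𝓝 (∫ x, e y x * φ.1 x)) := by
    intro φ
    refine (((continuous_weakSpace_integral_mul φ).tendsto y).mono_left hU).congr' ?_
    filter_upwards [hS] with z hz
    refine integral_congr_ae ?_
    filter_upwards [hae z hz] with x hx
    rw [← hx]
  obtain ⟨P', hP', Q', b', -, -, -, hs, hpsd, hne, hae'⟩ :=
    exists_polyExp_of_tendsto_ultrafilter U hP hQ hA (hLp.locallyIntegrable hr1.out) hlim hy0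
  have hfin : eLpNorm (polyExp P' Q' b') r volume < ⊤ := by
    rw [← eLpNorm_congr_ae hae']
    exact hLp.2
  exact ⟨_, polyExp_mem_polyGaussians hP' hs (posDef_of_eLpNorm_lt_top hs hpsd hne hr0 hr hfin) b',
    hae'⟩

end GaussianWavePacket

theorem mainTheorem2 (d : ℕ) (hd : 1 ≤ d) (ν : Fin d → ℕ) (r : ℝ≥0∞) [Fact (1 ≤ r)]
    (hr : r ≠ ⊤) :
    (∀ (P : ℕ → MvPolynomial (Fin d) ℂ) (p q : ℕ → EuclideanSpace ℝ (Fin d))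
        (A B : ℕ → Matrix (Fin d) (Fin d) ℝ) (g : EuclideanSpace ℝ (Fin d) → ℂ),
      (∀ k, P k ∈ GaussianWavePacket.boxPolynomials ν) →
      (∀ k, (A k).PosDef) →
      (∀ k, (B k).IsSymm) →
      (⨆ k, eLpNorm (GaussianWavePacket.wavePacket (P k) (p k) (q k)
        (GaussianWavePacket.cmat (A k) (B k))) r volume) < ⊤ →
      LocallyIntegrable g volume →
      GaussianWavePacket.TendstoDistribution
        (fun k => GaussianWavePacket.wavePacket (P k) (p k) (q k)
          (GaussianWavePacket.cmat (A k) (B k))) g →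
      g =ᵐ[volume] 0 ∨
      ∃ (P' : MvPolynomial (Fin d) ℂ) (p' q' : EuclideanSpace ℝ (Fin d))
        (A' B' : Matrix (Fin d) (Fin d) ℝ),
        P' ∈ GaussianWavePacket.boxPolynomials ν ∧ A'.PosDef ∧ B'.IsSymm ∧
        g =ᵐ[volume] GaussianWavePacket.wavePacket P' p' q' (GaussianWavePacket.cmat A' B') ∧
        GaussianWavePacket.wavePacket P' p' q' (GaussianWavePacket.cmat A' B') ∈
          GaussianWavePacket.polyGaussians ν \ {0} ∧
        (∀ θ : Fin d →₀ ℕ,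
          Tendsto (fun k => (P k).coeff θ) atTop (𝓝 (P'.coeff θ))) ∧
        Tendsto p atTop (𝓝 p') ∧
        Tendsto q atTop (𝓝 q') ∧
        Tendsto (fun k => GaussianWavePacket.cmat (A k) (B k)) atTop
          (𝓝 (GaussianWavePacket.cmat A' B')) ∧
        ∀ s : ℝ≥0∞, 1 ≤ s →
          Tendsto (fun k => eLpNorm (fun x => GaussianWavePacket.wavePacket (P k) (p k) (q k)
            (GaussianWavePacket.cmat (A k) (B k)) x - g x) s volume) atTop (𝓝 0)) ∧
    IsClosed (toWeakSpace ℂ (Lp ℂ r (volume : Measure (EuclideanSpace ℝ (Fin d)))) ''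
      GaussianWavePacket.polyGaussiansLp ν r) := by
  refine ⟨fun P p q A B g hP hA hB hbdd hg hlim => ?_,
    GaussianWavePacket.isClosed_polyGaussiansLp ν r hr⟩
  by_cases hg0 : g =ᵐ[volume] 0
  · exact Or.inl hg0
  · exact Or.inr (GaussianWavePacket.wavePacket_limit
      (zero_lt_one.trans_le (Fact.out : 1 ≤ r)).ne' hr hP hA hB hbdd hg hlim hg0)
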